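/- For $n \ge 2$ the game NIM$(n,n-1)$ is played on $n$ piles of stones; a position is a vector $x=(x_1,\dots,x_n)$ of nonnegative integers, and a move consists of choosing $n-1$ nonempty piles and removing exactly one stone from each of them. Two players alternate turns, and a player who has to move but cannot loses. Smith's remoteness function $\mathcal{R}$ assigns a nonnegative integer to each position as follows: give the value $0$ to all terminal positions and the value $1$ to all positions with a move to a terminal position; delete all positions that have received a value, and repeat this in the remaining digraph with the values $2,3$, then $4,5$, and so on. Theorem. The function $\mathcal{R}$ can be computed in polynomial time, even if $n$ is a part of the input and the integers are presented in binary. That is, there is one multi-tape Turing machine that, for every $n\ge 2$ and every position $x=(x_1,\dots,x_n)$ of NIM$(n,n-1)$, given the binary expansions of $x_1,\dots,x_n$ (separated by commas), outputs $\mathcal{R}(x)$ in binary, in time polynomial in the length of the input. Hence, P-positions (the positions in which the player who is not to move has a winning strategy) can be recognized in polynomial time: there is such a machine that decides whether $x$ is a P-position of NIM$(n,n-1)$. -/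

import Mathlib

open Computability Turing

/-! ### Impartial games given by a move relation -/

section Games

variable {α : Type*}

/-- The terminal positions of the subgraph induced on `A`: no move stays inside `A`. -/
def terminalIn (Move : α → α → Prop) (A : Set α) : Set α :=
  {x | x ∈ A ∧ ∀ y, Move x y → y ∉ A}

/-- The positions of `A` from which some move leads to a terminal position of the subgraph
induced on `A`. -/
def preTerminalIn (Move : α → α → Prop) (A : Set α) : Set α :=
  {x | x ∈ A ∧ ∃ y, Move x y ∧ y ∈ terminalIn Move A}

/-- The positions that are still present after `j` rounds of Smith's algorithm. In every round the
terminal positions of the present digraph and the positions with a move to one of them are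
labelled, and then deleted. -/
def smithRemaining (Move : α → α → Prop) : ℕ → Set α
  | 0 => Set.univ
  | j + 1 => smithRemaining Move j \
      (terminalIn Move (smithRemaining Move j) ∪ preTerminalIn Move (smithRemaining Move j))

/-- Smith's algorithm gives `x` the label `r`: in round `j = 0, 1, 2, …` the label `2 * j` is given
to the terminal positions of the present digraph, and the label `2 * j + 1` to the positions with a
move to one of them. -/
inductive HasRemoteness (Move : α → α → Prop) (x : α) : ℕ → Prop
  | even (j : ℕ) (h : x ∈ terminalIn Move (smithRemaining Move j)) : HasRemoteness Move x (2 * j)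
  | odd (j : ℕ) (h : x ∈ preTerminalIn Move (smithRemaining Move j)) :
      HasRemoteness Move x (2 * j + 1)

/-- Smith's remoteness function: the label that Smith's algorithm gives to `x`. (For games in which
the length of a play is bounded by a function of the initial position there is exactly one label,
see `hasRemoteness_iff`.) -/
noncomputable def remoteness (Move : α → α → Prop) (x : α) : ℕ :=
  sInf {r | HasRemoteness Move x r}

/-- `x` is a P-position (under the normal play convention, where the player who has to move but
cannot loses): the player who is not to move has a winning strategy, that is, a reply to each move
from `x` that leads to a P-position again. -/
inductive IsPPosition (Move : α → α → Prop) : α → Prop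
  | intro {x : α} (reply : α → α) (legal : ∀ y, Move x y → Move y (reply y))
      (wins : ∀ y, Move x y → IsPPosition Move (reply y)) : IsPPosition Move x

theorem smithRemaining_antitone (Move : α → α → Prop) : Antitone (smithRemaining Move) :=
  antitone_nat_of_succ_le fun _ _ hx => hx.1

theorem exists_hasRemoteness {Move : α → α → Prop} (rank : α → ℕ)
    (hrank : ∀ x y, Move x y → rank y < rank x) (x : α) : ∃ r, HasRemoteness Move x r := by
  classical
  have key : ∀ m, ∀ x, rank x ≤ m → x ∉ smithRemaining Move (m + 1) := by
    intro m
    induction m with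
    | zero =>
      intro x hx h
      exact h.2 (Or.inl ⟨h.1, fun y hy => by have := hrank x y hy; omega⟩)
    | succ m ih =>
      intro x hx h
      exact h.2 (Or.inl ⟨h.1, fun y hy => ih y (by have := hrank x y hy; omega)⟩)
  have hex : ∃ j, x ∉ smithRemaining Move j := ⟨_, key _ x le_rfl⟩
  have hf := Nat.find_spec hex
  have hmin : ∀ j, j < Nat.find hex → x ∈ smithRemaining Move j := fun j hj =>
    not_not.1 (Nat.find_min hex hj)
  rcases hj : Nat.find hex with _ | j
  · rw [hj] at hf
    exact absurd (Set.mem_univ x) hf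
  · rw [hj] at hf hmin
    have hx := hmin j (Nat.lt_succ_self j)
    by_contra hno
    refine hf ⟨hx, ?_⟩
    rintro (h | h)
    · exact hno ⟨_, .even j h⟩
    · exact hno ⟨_, .odd j h⟩

theorem HasRemoteness.unique {Move : α → α → Prop} {x : α} {r s : ℕ}
    (hr : HasRemoteness Move x r) (hs : HasRemoteness Move x s) : r = s := by
  have key : ∀ i j, x ∈ terminalIn Move (smithRemaining Move i) ∪
      preTerminalIn Move (smithRemaining Move i) → x ∈ smithRemaining Move j → j ≤ i := by
    intro i j hi hj
    by_contra hlt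
    exact ((smithRemaining_antitone Move (Nat.succ_le_of_lt (not_le.1 hlt))) hj).2 hi
  rcases hr with ⟨i, hi⟩ | ⟨i, hi⟩ <;> rcases hs with ⟨j, hj⟩ | ⟨j, hj⟩
  · have := key i j (Or.inl hi) hj.1
    have := key j i (Or.inl hj) hi.1
    omega
  · obtain rfl : i = j := le_antisymm (key j i (Or.inr hj) hi.1) (key i j (Or.inl hi) hj.1)
    obtain ⟨y, hy, hyt⟩ := hj.2
    exact absurd hyt.1 (hi.2 y hy)
  · obtain rfl : i = j := le_antisymm (key j i (Or.inl hj) hi.1) (key i j (Or.inr hi) hj.1)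
    obtain ⟨y, hy, hyt⟩ := hi.2
    exact absurd hyt.1 (hj.2 y hy)
  · have := key i j (Or.inr hi) hj.1
    have := key j i (Or.inr hj) hi.1
    omega

theorem hasRemoteness_iff {Move : α → α → Prop} (rank : α → ℕ)
    (hrank : ∀ x y, Move x y → rank y < rank x) (x : α) (r : ℕ) :
    HasRemoteness Move x r ↔ r = remoteness Move x := by
  have h : HasRemoteness Move x (remoteness Move x) :=
    Nat.sInf_mem (exists_hasRemoteness rank hrank x)
  exact ⟨fun hr => hr.unique h, fun hr => hr ▸ h⟩

end Games

/-! ### The game NIM(n, k) -/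

/-- The moves of NIM(n, k): choose `k` nonempty piles out of `n`, and remove exactly one stone from
each of them. -/
def NimMove (n k : ℕ) (x y : Fin n → ℕ) : Prop :=
  ∃ S : Finset (Fin n), S.card = k ∧ (∀ i ∈ S, 0 < x i) ∧
    ∀ i, y i = if i ∈ S then x i - 1 else x i

/-- Each move of NIM(n, k), `0 < k`, decreases the number of stones, so that Smith's algorithm
gives exactly one label to each position. -/
theorem nim_hasRemoteness_iff {n k : ℕ} (hk : 0 < k) (x : Fin n → ℕ) (r : ℕ) :
    HasRemoteness (NimMove n k) x r ↔ r = remoteness (NimMove n k) x := by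
  refine hasRemoteness_iff (fun x => ∑ i, x i) ?_ x r
  rintro x y ⟨S, hS, hpos, hy⟩
  obtain ⟨i, hi⟩ := Finset.card_pos.1 (hS ▸ hk)
  refine Finset.sum_lt_sum (fun j _ => ?_) ⟨i, Finset.mem_univ i, ?_⟩
  · rw [hy j]
    split_ifs <;> omega
  · have := hpos i hi
    rw [hy i, if_pos hi]
    omega

/-- A position of one of the games NIM(n, n - 1): a number `n ≥ 2` of piles (so that `n - 1 > 0`)
and the numbers of stones in the piles. -/
structure NimPosition where
  n : ℕ
  two_le : 2 ≤ n
  pile : Fin n → ℕ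

/-- The remoteness of a position in NIM(n, n - 1). -/
noncomputable def NimPosition.rem (p : NimPosition) : ℕ :=
  remoteness (NimMove p.n (p.n - 1)) p.pile

/-- `p` is a P-position of NIM(n, n - 1). -/
def NimPosition.IsP (p : NimPosition) : Prop :=
  IsPPosition (NimMove p.n (p.n - 1)) p.pile

/-- The position as a word over the alphabet `Γ'`: the binary digits of the pile sizes, each of the
`n` numbers followed by a comma. -/
def NimPosition.encode (p : NimPosition) : List Γ' :=
  (List.ofFn p.pile).flatMap fun m => (encodeNat m).map Γ'.bit ++ [Γ'.comma]

/-! ### Polynomial time -/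

/-- `f` is computable in polynomial time by a multi-tape Turing machine, with respect to the
encodings `ea` and `eb`. All tape alphabets are finite. -/
def PolyTimeComputable {α β A B : Type} (ea : α → List A) (eb : β → List B) (f : α → β) : Prop :=
  ∃ M : TM2ComputableInPolyTime ea eb f, ∀ k, Finite (M.tm.Γ k)

/-! ### Recognizing the remoteness function by its recursion -/

/-! Call `T - x i` the deficit of a pile `i` that has fewer than `T` stones. If a move keeps the
pile `j` and `T` is lowered by one along with it, every deficit is unchanged except that of `j`,
which falls by one. So `T` moves give out `T` stones, one each, to fill the deficits. Count these
stones in pairs: pile `i` needs half its deficit, rounded up, and a move completes a pair only if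
the deficit of the kept pile is odd. A player who wants a short play keeps a pile with even deficit
and completes nothing, so the budget is `T / 2` pairs. One more pair is gained if completing one is
possible at odd `T` (some deficit is odd) or unavoidable at even `T` (all deficits are odd). This is
the criterion `Lasts`.

`Lasts x T` is downward closed and bounded in `T`. Its maximum `lastsMax` obeys three rules: from an
even value all moves lead to smaller odd values; from an odd value no move leads to an even value
smaller by more than one; from a positive value some move lowers it by exactly one. By
`remoteness_eq_of_recursion` the rules force it to be the remoteness, and by
`isPPosition_iff_of_recursion` the P-positions are those with even value. The third rule,
`exists_keepMove`, comes from one explicit move: keep a smallest even pile, or a largest pile if all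
are odd.

By monotonicity the remoteness can be found by binary search, one binary digit per round. It is at
most the number of stones, so as many digits as input symbols suffice. A round starts with a budget
of `T + 2`, subtracts each deficit rounded up to an even number, and records whether some or all
deficits are odd. Each of the at most `N` piles takes a linear number of steps, so `N` rounds take
cubic time. -/

section Recursion

variable {α : Type*} {Move : α → α → Prop} {F : α → ℕ}

/-- Where `2 * j ≤ F`, a position of value `2 * j` is terminal because its moves drop below `2 * j`;
a larger value is not, because it can be lowered by one. A move to value `2 * j` cannot start at an
even value, and by `hodd` it cannot start at an odd value above `2 * j + 1`. -/
theorem smithRemaining_eq_of_recursion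
    (hlt : ∀ x y, Move x y → F x % 2 = 0 → F y % 2 = 1 ∧ F y < F x)
    (hodd : ∀ x y, Move x y → F x % 2 = 1 → F y % 2 = 0 → F x ≤ F y + 1)
    (hex : ∀ x, 0 < F x → ∃ y, Move x y ∧ F y + 1 = F x) (j : ℕ) :
    smithRemaining Move j = {x | 2 * j ≤ F x} ∧
      terminalIn Move (smithRemaining Move j) = {x | F x = 2 * j} ∧
      preTerminalIn Move (smithRemaining Move j) = {x | F x = 2 * j + 1} := by
  have key : ∀ j, ∀ A : Set α, A = {x | 2 * j ≤ F x} →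
      terminalIn Move A = {x | F x = 2 * j} ∧ preTerminalIn Move A = {x | F x = 2 * j + 1} := by
    rintro j A rfl
    have ht : terminalIn Move {x | 2 * j ≤ F x} = {x | F x = 2 * j} := by
      ext x
      simp only [terminalIn, Set.mem_ofPred_eq]
      constructor
      · rintro ⟨h1, h2⟩
        by_contra hne
        obtain ⟨y, hy, hFy⟩ := hex x (by omega)
        exact h2 y hy (by omega)
      · intro h
        refine ⟨h.ge, fun y hy hle => ?_⟩
        have := hlt x y hy (by omega)
        omega
    refine ⟨ht, ?_⟩
    unfold preTerminalIn
    rw [ht]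
    ext x
    simp only [Set.mem_ofPred_eq]
    constructor
    · rintro ⟨h1, y, hy, hFy⟩
      rcases Nat.mod_two_eq_zero_or_one (F x) with h | h
      · have := hlt x y hy h
        omega
      · have := hodd x y hy h (by omega)
        omega
    · intro h
      obtain ⟨y, hy, hFy⟩ := hex x (by omega)
      exact ⟨by omega, y, hy, by omega⟩
  have main : ∀ j, smithRemaining Move j = {x | 2 * j ≤ F x} := by
    intro j
    induction j with
    | zero => simp [smithRemaining]
    | succ j ih =>
      obtain ⟨h1, h2⟩ := key j _ ih
      rw [smithRemaining, h1, h2, ih]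
      ext x
      simp only [Set.mem_sdiff, Set.mem_union, Set.mem_ofPred_eq]
      omega
  exact ⟨main j, key j _ (main j)⟩

theorem remoteness_eq_of_recursion (rank : α → ℕ) (hrank : ∀ x y, Move x y → rank y < rank x)
    (hlt : ∀ x y, Move x y → F x % 2 = 0 → F y % 2 = 1 ∧ F y < F x)
    (hodd : ∀ x y, Move x y → F x % 2 = 1 → F y % 2 = 0 → F x ≤ F y + 1)
    (hex : ∀ x, 0 < F x → ∃ y, Move x y ∧ F y + 1 = F x) (x : α) :
    remoteness Move x = F x := by
  symm
  rw [← hasRemoteness_iff rank hrank]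
  obtain ⟨-, h1, h2⟩ := smithRemaining_eq_of_recursion hlt hodd hex (F x / 2)
  rcases Nat.mod_two_eq_zero_or_one (F x) with h | h
  · have hx : F x = 2 * (F x / 2) := by omega
    have := HasRemoteness.even (Move := Move) (x := x) (F x / 2) (h1 ▸ hx)
    rwa [← hx] at this
  · have hx : F x = 2 * (F x / 2) + 1 := by omega
    have := HasRemoteness.odd (Move := Move) (x := x) (F x / 2) (h2 ▸ hx)
    rwa [← hx] at this

/-- The winning reply lowers the odd value by one and so restores an even value. Conversely, the
player to move at an odd value passes an even one to the opponent, whose reply is then odd again. -/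
theorem isPPosition_iff_of_recursion
    (hlt : ∀ x y, Move x y → F x % 2 = 0 → F y % 2 = 1 ∧ F y < F x)
    (hex : ∀ x, 0 < F x → ∃ y, Move x y ∧ F y + 1 = F x) (x : α) :
    IsPPosition Move x ↔ F x % 2 = 0 := by
  constructor
  · intro h
    induction h with
    | @intro x reply legal wins ih =>
      by_contra hx
      obtain ⟨y, hy, hFy⟩ := hex x (by omega)
      have := hlt y _ (legal y hy) (by omega)
      have := ih y hy
      omega
  · intro hx
    induction hn : F x using Nat.strong_induction_on generalizing x with
    | _ m ih =>
      have hreply : ∀ y, ∃ z, Move x y → Move y z ∧ F z + 1 = F y := by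
        intro y
        by_cases hy : Move x y
        · obtain ⟨z, hz⟩ := hex y (by have := hlt x y hy hx; omega)
          exact ⟨z, fun _ => hz⟩
        · exact ⟨y, fun h => absurd h hy⟩
      choose reply hr using hreply
      refine .intro reply (fun y hy => (hr y hy).1) fun y hy => ?_
      have h1 := hlt x y hy hx
      have h2 := (hr y hy).2
      exact ih (F (reply y)) (by omega) _ (by omega) rfl

end Recursion

/-! ### The remoteness function of NIM(n, n - 1) -/

section Nim

variable {n : ℕ}

/-- The number of pairs of stones that have to be put on the piles of `x` so that each of them has
at least `T` stones. -/
def pairDeficit (x : Fin n → ℕ) (T : ℕ) : ℕ := ∑ i, (T - x i + 1) / 2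

/-- The pile `i` has less than `T` stones, and the difference is odd. -/
def OddBelow (x : Fin n → ℕ) (T : ℕ) (i : Fin n) : Prop := x i < T ∧ x i % 2 ≠ T % 2

/-- The condition under which one more pair of stones is available. -/
def Bonus (x : Fin n → ℕ) (T : ℕ) : Prop :=
  (T % 2 = 1 ∧ ∃ i, OddBelow x T i) ∨ (T % 2 = 0 ∧ ∀ i, OddBelow x T i)

/-- The criterion for `T ≤ R x` in NIM(n, n - 1), where `R` is the remoteness function. -/
def Lasts (x : Fin n → ℕ) (T : ℕ) : Prop :=
  pairDeficit x T ≤ T / 2 ∨ (Bonus x T ∧ pairDeficit x T ≤ T / 2 + 1)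

/-! ### Dependence of the criterion on `T` -/

theorem pairDeficit_succ_of_none {x : Fin n → ℕ} {T : ℕ} (h : ∀ i, ¬ OddBelow x (T + 1) i) :
    pairDeficit x (T + 1) = pairDeficit x T := by
  refine Finset.sum_congr rfl fun i _ => ?_
  have := h i
  unfold OddBelow at this
  omega

theorem pairDeficit_mono (x : Fin n → ℕ) (T : ℕ) : pairDeficit x T ≤ pairDeficit x (T + 1) :=
  Finset.sum_le_sum fun i _ => by omega

theorem pairDeficit_lt_succ {x : Fin n → ℕ} {T : ℕ} (h : ∃ i, OddBelow x (T + 1) i) :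
    pairDeficit x T < pairDeficit x (T + 1) := by
  obtain ⟨i, hi⟩ := h
  refine Finset.sum_lt_sum (fun i _ => by omega) ⟨i, Finset.mem_univ i, ?_⟩
  unfold OddBelow at hi
  omega

theorem pairDeficit_succ_of_all {x : Fin n → ℕ} {T : ℕ} (h : ∀ i, OddBelow x (T + 1) i) :
    pairDeficit x (T + 1) = pairDeficit x T + n := by
  have : pairDeficit x T + n = ∑ i, ((T - x i + 1) / 2 + 1) := by
    simp [pairDeficit, Finset.sum_add_distrib]
  rw [this]
  refine Finset.sum_congr rfl fun i _ => ?_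
  have := h i
  unfold OddBelow at this
  omega

theorem pairDeficit_eq_zero {x : Fin n → ℕ} {T : ℕ} (h : ∀ i, T ≤ x i) : pairDeficit x T = 0 :=
  Finset.sum_eq_zero fun i _ => by have := h i; omega

theorem le_pairDeficit_of_ne {x : Fin n → ℕ} {i j : Fin n} (hij : i ≠ j) (T : ℕ) :
    (T - x i + 1) / 2 + (T - x j + 1) / 2 ≤ pairDeficit x T := by
  rw [← Finset.sum_pair (f := fun i => (T - x i + 1) / 2) hij]
  exact Finset.sum_le_sum_of_subset (Finset.subset_univ _)

/-- For even `T` the budget is the same at `T + 1`, and a bonus there comes from an odd deficit,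
which disappears at `T`. For odd `T` the budget drops by one. If all deficits at `T + 1` are odd,
the `n ≥ 2` pairs saved pay for this and for the bonus. Otherwise an odd deficit at `T` gives a
bonus, or one at `T + 1` saves a pair. With neither, no pile is below `T`, since a pile below `T`
has an odd deficit at `T` or at `T + 1`. -/
theorem Lasts.of_succ (hn : 2 ≤ n) {x : Fin n → ℕ} {T : ℕ} (h : Lasts x (T + 1)) : Lasts x T := by
  have hmono := pairDeficit_mono x T
  rcases Nat.mod_two_eq_zero_or_one T with hT | hT
  · left
    by_cases hex : ∃ i, OddBelow x (T + 1) i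
    · have := pairDeficit_lt_succ hex
      rcases h with h | ⟨-, h⟩ <;> omega
    · rcases h with h | ⟨(⟨-, h⟩ | ⟨h, -⟩), -⟩
      · omega
      · exact absurd h hex
      · omega
  · by_cases hall : ∀ i, OddBelow x (T + 1) i
    · left
      have := pairDeficit_succ_of_all hall
      rcases h with h | ⟨-, h⟩ <;> omega
    have h' : pairDeficit x (T + 1) ≤ (T + 1) / 2 := by
      rcases h with h | ⟨(⟨h, -⟩ | ⟨-, h⟩), -⟩
      · exact h
      · omega
      · exact absurd h hall
    by_cases hT' : ∃ i, OddBelow x T i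
    · exact .inr ⟨.inl ⟨hT, hT'⟩, by omega⟩
    by_cases hex : ∃ i, OddBelow x (T + 1) i
    · have := pairDeficit_lt_succ hex
      left; omega
    · left
      rw [pairDeficit_eq_zero]
      · exact Nat.zero_le _
      · intro i
        by_contra hi
        push Not at hT' hex
        have h1 := hT' i
        have h2 := hex i
        unfold OddBelow at h1 h2
        omega

theorem Lasts.mono (hn : 2 ≤ n) {x : Fin n → ℕ} {T T' : ℕ} (hle : T ≤ T') (h : Lasts x T') :
    Lasts x T := by
  induction hle with
  | refl => exact h
  | step _ ih => exact ih (h.of_succ hn)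

theorem lasts_zero (x : Fin n → ℕ) : Lasts x 0 :=
  .inl (by rw [pairDeficit_eq_zero fun _ => Nat.zero_le _])

/-- The deficits of two piles alone already have to fit into `T + 2` stones. -/
theorem Lasts.le_add {x : Fin n → ℕ} {T : ℕ} (h : Lasts x T) {i j : Fin n} (hij : i ≠ j) :
    T ≤ x i + x j + 2 := by
  have := le_pairDeficit_of_ne hij (x := x) T
  rcases h with h | ⟨-, h⟩ <;> omega

theorem exists_lasts_iff (hn : 2 ≤ n) (x : Fin n → ℕ) : ∃ r, ∀ T, Lasts x T ↔ T ≤ r := by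
  classical
  have hex : ∃ T, ¬ Lasts x T := by
    refine ⟨x ⟨0, by omega⟩ + x ⟨1, by omega⟩ + 3, fun h => ?_⟩
    have := h.le_add (i := ⟨0, by omega⟩) (j := ⟨1, by omega⟩) (by simp)
    omega
  have hpos : 0 < Nat.find hex := Nat.pos_of_ne_zero fun h0 => Nat.find_spec hex (h0 ▸ lasts_zero x)
  refine ⟨Nat.find hex - 1, fun T => ⟨fun h => ?_, fun h => ?_⟩⟩
  · by_contra hlt
    exact Nat.find_spec hex (h.mono hn (by omega))
  · exact not_not.1 (Nat.find_min hex (by omega))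

/-- The greatest number `T` such that `Lasts x T`. -/
noncomputable def lastsMax (x : Fin n → ℕ) : ℕ := sSup {T | Lasts x T}

theorem lasts_iff (hn : 2 ≤ n) (x : Fin n → ℕ) (T : ℕ) : Lasts x T ↔ T ≤ lastsMax x := by
  obtain ⟨r, hr⟩ := exists_lasts_iff hn x
  have : lastsMax x = r := by
    have : {T | Lasts x T} = Set.Iic r := by ext T; exact hr T
    rw [lastsMax, this, csSup_Iic]
  rw [this, hr]

/-- `y` is obtained from `x` by the move that keeps the pile `j`. -/
def KeepMove (j : Fin n) (x y : Fin n → ℕ) : Prop :=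
  y j = x j ∧ ∀ i, i ≠ j → 0 < x i ∧ y i = x i - 1

/-! ### Effect of a move on the criterion -/

theorem nimMove_iff_keepMove (hn : 2 ≤ n) (x y : Fin n → ℕ) :
    NimMove n (n - 1) x y ↔ ∃ j, KeepMove j x y := by
  constructor
  · rintro ⟨S, hS, hpos, hy⟩
    have hc : Sᶜ.card = 1 := by rw [Finset.card_compl, Fintype.card_fin, hS]; omega
    obtain ⟨j, hj⟩ := Finset.card_eq_one.1 hc
    have hmem : ∀ i, i ∈ S ↔ i ≠ j := fun i => by
      rw [← not_iff_not, ← Finset.mem_compl, hj]; simp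
    refine ⟨j, by rw [hy, if_neg (by simp [hmem])], fun i hi => ?_⟩
    have := (hmem i).2 hi
    exact ⟨hpos i this, by rw [hy, if_pos this]⟩
  · rintro ⟨j, hj, h⟩
    refine ⟨{j}ᶜ, by simp [Finset.card_compl], fun i hi => (h i (by simpa using hi)).1, fun i => ?_⟩
    by_cases hi : i = j
    · simp [hi, hj]
    · simp [hi, (h i hi).2]

/-- From `x`, `T + 1` to `y`, `T` only the deficit of `j` changes, by one. Halving with rounding up
notices this exactly when the deficit was odd. -/
theorem KeepMove.pairDeficit_of_oddBelow {j : Fin n} {x y : Fin n → ℕ} (h : KeepMove j x y) {T : ℕ}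
    (hj : OddBelow x (T + 1) j) : pairDeficit x (T + 1) = pairDeficit y T + 1 := by
  unfold pairDeficit
  rw [← Finset.add_sum_erase _ _ (Finset.mem_univ j),
    ← Finset.add_sum_erase _ (fun i => (T - y i + 1) / 2) (Finset.mem_univ j), add_right_comm]
  congr 1
  · have := h.1
    unfold OddBelow at hj
    omega
  · refine Finset.sum_congr rfl fun i hi => ?_
    have := h.2 i (Finset.ne_of_mem_erase hi)
    omega

theorem KeepMove.pairDeficit_of_not {j : Fin n} {x y : Fin n → ℕ} (h : KeepMove j x y) {T : ℕ}
    (hj : ¬ OddBelow x (T + 1) j) : pairDeficit x (T + 1) = pairDeficit y T := by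
  refine Finset.sum_congr rfl fun i hi => ?_
  by_cases hij : i = j
  · subst hij
    have := h.1
    unfold OddBelow at hj
    omega
  · have := h.2 i hij
    omega

theorem KeepMove.oddBelow_succ {j : Fin n} {x y : Fin n → ℕ} (h : KeepMove j x y) {T : ℕ}
    {i : Fin n} (hi : i ≠ j) : OddBelow x (T + 1) i ↔ OddBelow y T i := by
  have := h.2 i hi
  unfold OddBelow
  omega

theorem exists_ne_fin (hn : 2 ≤ n) (j : Fin n) : ∃ i, i ≠ j :=
  have : Nontrivial (Fin n) := Fin.nontrivial_iff_two_le.2 hn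
  exists_ne j

/-- If the move completes a pair, the budget shrinks along with the need, and a bonus of `x` leaves
an odd deficit in another pile. If it completes none, an odd deficit at `T + 1` gives `y` the bonus;
without one, `y` needs no more pairs for `T + 1` than for `T`. -/
theorem KeepMove.lasts_odd (hn : 2 ≤ n) {j : Fin n} {x y : Fin n → ℕ} (h : KeepMove j x y) {T : ℕ}
    (hT : T % 2 = 0) (hx : Lasts x (T + 2)) (hy : Lasts y T) : Lasts y (T + 1) := by
  by_cases hj : OddBelow x (T + 2) j
  · have h1 : pairDeficit x (T + 2) = _ := h.pairDeficit_of_oddBelow hj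
    rcases hx with hx | ⟨(⟨hx, -⟩ | ⟨-, hx⟩), hle⟩
    · left; omega
    · omega
    · obtain ⟨i, hi⟩ := exists_ne_fin hn j
      exact .inr ⟨.inl ⟨by omega, i, (h.oddBelow_succ hi).1 (hx i)⟩, by omega⟩
  · have h1 : pairDeficit x (T + 2) = _ := h.pairDeficit_of_not hj
    have h2 : pairDeficit x (T + 2) ≤ (T + 2) / 2 := by
      rcases hx with hx | ⟨(⟨hx, -⟩ | ⟨-, hx⟩), hle⟩
      · exact hx
      · omega
      · exact absurd (hx j) hj
    by_cases hex : ∃ i, OddBelow y (T + 1) i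
    · exact .inr ⟨.inl ⟨by omega, hex⟩, by omega⟩
    · push Not at hex
      left
      rw [pairDeficit_succ_of_none hex]
      rcases hy with hy | ⟨(⟨hy, -⟩ | ⟨-, hy⟩), hle⟩
      · omega
      · omega
      · have h3 := hy j
        have := h.1
        unfold OddBelow at hj h3
        omega

/-- Contrapositively: if `y` lasts `T`, the extra pair that `x` may need is covered by the bonus
from pile `j`. If `y` itself uses a bonus, then all its deficits are odd, and another pile than `j`
passes the bonus on to `x`. -/
theorem KeepMove.not_lasts_even (hn : 2 ≤ n) {j : Fin n} {x y : Fin n → ℕ} (h : KeepMove j x y)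
    {T : ℕ} (hT : T % 2 = 0) (hx : ¬ Lasts x (T + 1)) : ¬ Lasts y T := by
  intro hy
  obtain ⟨i, hi⟩ := exists_ne_fin hn j
  by_cases hj : OddBelow x (T + 1) j
  · have h1 := h.pairDeficit_of_oddBelow hj
    rcases hy with hy | ⟨(⟨hy, -⟩ | ⟨-, hy⟩), hle⟩
    · exact hx (.inr ⟨.inl ⟨by omega, j, hj⟩, by omega⟩)
    · omega
    · have h3 := hy j
      have := h.1
      unfold OddBelow at hj h3
      omega
  · have h1 := h.pairDeficit_of_not hj
    rcases hy with hy | ⟨(⟨hy, -⟩ | ⟨-, hy⟩), hle⟩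
    · exact hx (.inl (by omega))
    · omega
    · exact hx (.inr ⟨.inl ⟨by omega, i, (h.oddBelow_succ hi).2 (hy i)⟩, by omega⟩)

/-- The pile kept by an optimal move: a smallest even pile, or a largest pile if all are odd. -/
theorem exists_kept_pile (hn : 2 ≤ n) (x : Fin n → ℕ) :
    ∃ j, (x j % 2 = 0 ∧ ∀ i, x i % 2 = 0 → x j ≤ x i) ∨
      ((∀ i, x i % 2 = 1) ∧ ∀ i, x i ≤ x j) := by
  by_cases hex : ∃ i, x i % 2 = 0
  · obtain ⟨i, hi⟩ := hex
    obtain ⟨j, hj, hmin⟩ := Finset.exists_min_image (Finset.univ.filter fun i => x i % 2 = 0) x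
      ⟨i, by simpa using hi⟩
    exact ⟨j, .inl ⟨by simpa using hj, fun i hi => hmin i (by simpa using hi)⟩⟩
  · push Not at hex
    obtain ⟨j, -, hmax⟩ := Finset.exists_max_image (Finset.univ : Finset (Fin n)) x
      ⟨⟨0, by omega⟩, Finset.mem_univ _⟩
    exact ⟨j, .inr ⟨fun i => by have := hex i; omega, fun i => hmax i (Finset.mem_univ i)⟩⟩

/-- One choice of `j` serves both parities: an even pile below an odd bound has an odd deficit, so
keeping it completes a pair, while below an even bound it completes none. -/
theorem exists_keepMove (hn : 2 ≤ n) {x : Fin n → ℕ} {T : ℕ} (hx : Lasts x (T + 1))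
    (hx' : ¬ Lasts x (T + 2)) : ∃ j y, KeepMove j x y ∧ Lasts y T ∧ ¬ Lasts y (T + 1) := by
  obtain ⟨j, hj⟩ := exists_kept_pile hn x
  have hpos : ∀ i, i ≠ j → 0 < x i := by
    intro i hi
    rcases hj with ⟨-, hj⟩ | ⟨hj, -⟩
    · by_contra h0
      have h1 := hj i (by omega)
      -- If `x i` were empty, the kept smallest even pile would be empty too, and two empty piles
      -- need two pairs at `T = 1`, where at most one is available.
      have h2 : Lasts x 1 := hx.mono hn (by omega)
      have h3 := le_pairDeficit_of_ne hi (x := x) 1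
      rcases h2 with h2 | ⟨-, h2⟩ <;> omega
    · have := hj i
      omega
  refine ⟨j, fun i => if i = j then x i else x i - 1, ?_⟩
  generalize hyd : (fun i => if i = j then x i else x i - 1) = y
  have h : KeepMove j x y := by
    subst hyd
    exact ⟨by simp, fun i hi => ⟨hpos i hi, by simp [hi]⟩⟩
  refine ⟨h, ?_⟩
  rcases Nat.mod_two_eq_zero_or_one T with hT | hT
  · have hdef : pairDeficit y T ≤ T / 2 := by
      by_cases hjb : OddBelow x (T + 1) j
      · have := h.pairDeficit_of_oddBelow hjb
        rcases hx with hx | ⟨-, hx⟩ <;> omega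
      · rw [← h.pairDeficit_of_not hjb]
        -- A bonus at the odd number `T + 1` comes from an even pile below it; then the smallest
        -- even pile `j` is also below it, with odd deficit.
        rcases hx with hx | ⟨(⟨-, i, hi⟩ | ⟨hx, -⟩), -⟩
        · omega
        · exfalso
          unfold OddBelow at hi hjb
          rcases hj with ⟨hj1, hj⟩ | ⟨hj, -⟩
          · have := hj i
            omega
          · have := hj i
            omega
        · omega
    refine ⟨.inl hdef, ?_⟩
    intro hy
    by_cases hjb : OddBelow x (T + 2) j
    · have h1 : pairDeficit x (T + 2) = _ := h.pairDeficit_of_oddBelow hjb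
      -- Here `x j` is odd, so all piles are odd and `j` is a largest one; with it all lie below `T
      -- + 2`.
      have hall : ∀ i, OddBelow x (T + 2) i := by
        intro i
        unfold OddBelow at hjb ⊢
        rcases hj with ⟨hj1, hj⟩ | ⟨hj, hj2⟩
        · omega
        · have := hj i
          have := hj2 i
          omega
      refine hx' (.inr ⟨.inr ⟨by omega, hall⟩, ?_⟩)
      rcases hy with hy | ⟨-, hy⟩ <;> omega
    · have h1 : pairDeficit x (T + 2) = _ := h.pairDeficit_of_not hjb
      refine hx' (.inl ?_)
      rcases hy with hy | ⟨-, hy⟩ <;> omega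
  · refine ⟨?_, h.not_lasts_even hn (by omega) hx'⟩
    by_cases hex : ∃ i, OddBelow y T i
    · right
      refine ⟨.inl ⟨hT, hex⟩, ?_⟩
      by_cases hjb : OddBelow x (T + 1) j
      · have := h.pairDeficit_of_oddBelow hjb
        rcases hx with hx | ⟨-, hx⟩ <;> omega
      · rw [← h.pairDeficit_of_not hjb]
        rcases hx with hx | ⟨(⟨hx, -⟩ | ⟨-, hx⟩), -⟩
        · omega
        · omega
        · exact absurd (hx j) hjb
    · left
      push Not at hex
      -- All piles of `y` have at least `T` stones: one below `T` would have an odd size. If it is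
      -- `j`, all piles of `x` are odd and at most `x j`, so any other pile becomes even and has an
      -- odd deficit. If not, it was even in `x`, and then `j` has an odd deficit.
      rw [pairDeficit_eq_zero]
      · exact Nat.zero_le _
      intro i
      have h1 := hex i
      by_cases hij : i = j
      · subst hij
        by_contra hlt
        have h2 := h.1
        obtain ⟨k, hk⟩ := exists_ne_fin hn i
        have h3 := hex k
        have h4 := h.2 k hk
        unfold OddBelow at h1 h3
        rcases hj with ⟨hj1, hj⟩ | ⟨hj, hj2⟩
        · omega
        · have := hj k
          have := hj2 k
          omega
      · by_contra hlt
        have h2 := h.2 i hij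
        have h3 := hex j
        have h4 := h.1
        unfold OddBelow at h1 h3
        rcases hj with ⟨hj1, hj⟩ | ⟨hj, hj2⟩
        · have := hj i
          omega
        · have := hj i
          omega

/-! ### The recursion satisfied by `lastsMax` -/

theorem lastsMax_of_even (hn : 2 ≤ n) {x y : Fin n → ℕ} (h : NimMove n (n - 1) x y)
    (hx : lastsMax x % 2 = 0) : lastsMax y % 2 = 1 ∧ lastsMax y < lastsMax x := by
  obtain ⟨j, h⟩ := (nimMove_iff_keepMove hn x y).1 h
  have hlt : lastsMax y < lastsMax x := by
    have := h.not_lasts_even hn hx (by rw [lasts_iff hn]; omega)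
    rw [lasts_iff hn] at this
    omega
  refine ⟨?_, hlt⟩
  by_contra hy
  have := h.lasts_odd hn (T := lastsMax y) (by omega) ((lasts_iff hn _ _).2 (by omega))
    ((lasts_iff hn _ _).2 le_rfl)
  rw [lasts_iff hn] at this
  omega

theorem lastsMax_of_odd (hn : 2 ≤ n) {x y : Fin n → ℕ} (h : NimMove n (n - 1) x y)
    (hx : lastsMax x % 2 = 1) (hy : lastsMax y % 2 = 0) : lastsMax x ≤ lastsMax y + 1 := by
  obtain ⟨j, h⟩ := (nimMove_iff_keepMove hn x y).1 h
  by_contra hlt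
  have := h.lasts_odd hn (T := lastsMax y) hy ((lasts_iff hn _ _).2 (by omega))
    ((lasts_iff hn _ _).2 le_rfl)
  rw [lasts_iff hn] at this
  omega

theorem exists_nimMove_lastsMax (hn : 2 ≤ n) {x : Fin n → ℕ} (hx : 0 < lastsMax x) :
    ∃ y, NimMove n (n - 1) x y ∧ lastsMax y + 1 = lastsMax x := by
  obtain ⟨j, y, h, h1, h2⟩ := exists_keepMove hn (x := x) (T := lastsMax x - 1)
    ((lasts_iff hn _ _).2 (by omega)) (by rw [lasts_iff hn]; omega)
  rw [lasts_iff hn] at h1 h2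
  exact ⟨y, (nimMove_iff_keepMove hn x y).2 ⟨j, h⟩, by omega⟩

theorem nimMove_sum_lt (hn : 2 ≤ n) {x y : Fin n → ℕ} (h : NimMove n (n - 1) x y) :
    ∑ i, y i < ∑ i, x i := by
  obtain ⟨j, h⟩ := (nimMove_iff_keepMove hn x y).1 h
  obtain ⟨k, hk⟩ := exists_ne_fin hn j
  refine Finset.sum_lt_sum (fun i _ => ?_) ⟨k, Finset.mem_univ k, ?_⟩
  · by_cases hi : i = j
    · rw [hi, h.1]
    · have := h.2 i hi
      omega
  · have := h.2 k hk
    omega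

theorem remoteness_nim (hn : 2 ≤ n) (x : Fin n → ℕ) :
    remoteness (NimMove n (n - 1)) x = lastsMax x :=
  remoteness_eq_of_recursion (F := lastsMax) (fun x => ∑ i, x i) (fun _ _ h => nimMove_sum_lt hn h)
    (fun _ _ h => lastsMax_of_even hn h) (fun _ _ h => lastsMax_of_odd hn h)
    (fun _ => exists_nimMove_lastsMax hn) x

theorem isPPosition_nim (hn : 2 ≤ n) (x : Fin n → ℕ) :
    IsPPosition (NimMove n (n - 1)) x ↔ lastsMax x % 2 = 0 :=
  isPPosition_iff_of_recursion (F := lastsMax) (fun _ _ h => lastsMax_of_even hn h)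
    (fun _ => exists_nimMove_lastsMax hn) x

/-- Some move lowers the value by only one, and every move removes a stone. This bounds the number
of digits to be searched. -/
theorem lastsMax_le_sum (hn : 2 ≤ n) (x : Fin n → ℕ) : lastsMax x ≤ ∑ i, x i := by
  induction hs : ∑ i, x i using Nat.strong_induction_on generalizing x with
  | _ s ih =>
    by_contra hlt
    obtain ⟨y, hy, hl⟩ := exists_nimMove_lastsMax hn (x := x) (by omega)
    have h1 := nimMove_sum_lt hn hy
    have h2 := ih _ (hs ▸ h1) y rfl
    omega

end Nim

/-! ### Binary numbers as lists of bits -/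

section Bits

/-- The number with the given binary digits, the least significant digit first. -/
def bitsVal : List Bool → ℕ
  | [] => 0
  | b :: l => b.toNat + 2 * bitsVal l

/-- Delete the leading zeros, at the end of the list. -/
def trimBits (l : List Bool) : List Bool :=
  l.foldr (fun b out => if b || !out.isEmpty then b :: out else out) []

theorem trimBits_cons (b : Bool) (l : List Bool) :
    trimBits (b :: l) = if b || !(trimBits l).isEmpty then b :: trimBits l else trimBits l :=
  rfl

theorem trimBits_eq_nil_iff (l : List Bool) : trimBits l = [] ↔ bitsVal l = 0 := by
  induction l with
  | nil => simp [trimBits, bitsVal]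
  | cons b l ih =>
    rw [trimBits_cons, bitsVal]
    cases b
    · by_cases h : trimBits l = []
      · simp [h, ih.1 h]
      · simp [h, ← ih]
    · simp

/-- A list without leading zeros is determined by its value, so the trimmed output is the standard
encoding. -/
theorem trimBits_congr {l l' : List Bool} (h : bitsVal l = bitsVal l') :
    trimBits l = trimBits l' := by
  induction l generalizing l' with
  | nil => rw [(trimBits_eq_nil_iff l').2 h.symm]; rfl
  | cons b l ih =>
    cases l' with
    | nil => rw [(trimBits_eq_nil_iff _).2 h]; rfl
    | cons b' l' =>
      simp only [bitsVal] at h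
      have hb : b = b' := by cases b <;> cases b' <;> simp at h ⊢ <;> omega
      subst hb
      rw [trimBits_cons, trimBits_cons, ih (l' := l') (by omega)]

theorem bitsVal_encodePosNum (p : PosNum) : bitsVal (encodePosNum p) = p := by
  induction p with
  | one => rfl
  | bit0 p ih => simp [encodePosNum, bitsVal, ih, PosNum.cast_bit0]; omega
  | bit1 p ih => simp [encodePosNum, bitsVal, ih, PosNum.cast_bit1]; omega

theorem trimBits_encodePosNum (p : PosNum) : trimBits (encodePosNum p) = encodePosNum p := by
  induction p with
  | one => rfl
  | bit0 p ih => simp [encodePosNum, trimBits_cons, ih, encodePosNum_nonempty]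
  | bit1 p ih => simp [encodePosNum, trimBits_cons, ih]

theorem bitsVal_encodeNat (m : ℕ) : bitsVal (encodeNat m) = m := by
  conv_rhs => rw [← Num.to_of_nat m]
  unfold encodeNat
  cases (m : Num) with
  | zero => rfl
  | pos p => exact bitsVal_encodePosNum p

theorem trimBits_encodeNat (m : ℕ) : trimBits (encodeNat m) = encodeNat m := by
  unfold encodeNat
  cases (m : Num) with
  | zero => rfl
  | pos p => exact trimBits_encodePosNum p

theorem trimBits_eq_encodeNat (l : List Bool) : trimBits l = encodeNat (bitsVal l) := by
  rw [← trimBits_encodeNat]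
  exact trimBits_congr (bitsVal_encodeNat _).symm

theorem bitsVal_lt (l : List Bool) : bitsVal l < 2 ^ l.length := by
  induction l with
  | nil => simp [bitsVal]
  | cons b l ih =>
    have := Bool.toNat_le b
    simp only [bitsVal, List.length_cons, pow_succ]
    omega

theorem bitsVal_append (l l' : List Bool) :
    bitsVal (l ++ l') = bitsVal l + 2 ^ l.length * bitsVal l' := by
  induction l with
  | nil => simp [bitsVal]
  | cons b l ih =>
    simp only [List.cons_append, bitsVal, ih, List.length_cons, pow_succ]
    ring

theorem bitsVal_replicate_false (p : ℕ) : bitsVal (List.replicate p false) = 0 := by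
  induction p with
  | zero => rfl
  | succ p ih => simp [List.replicate_succ, bitsVal, ih]

/-- The difference digit of a full subtractor. -/
def subDigit (a b c : Bool) : Bool := a ^^ b ^^ c

/-- The outgoing borrow of a full subtractor. -/
def subBorrow (a b c : Bool) : Bool := (!a && (b || c)) || (b && c)

theorem toNat_sub (a b c : Bool) :
    a.toNat + 2 * (subBorrow a b c).toNat = b.toNat + c.toNat + (subDigit a b c).toNat := by
  cases a <;> cases b <;> cases c <;> rfl

end Bits

/-! ### The machine -/

namespace NimMachine

/-- The stacks: the input, the part of the input that has been read, the two parts of the working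
tape (less and more significant cells), and the output. -/
inductive Stk
  | inp
  | sav
  | lo
  | hi
  | out
  deriving DecidableEq

instance : Fintype Stk :=
  ⟨{.inp, .sav, .lo, .hi, .out}, by rintro (_ | _) <;> decide⟩

/-- A cell of the working tape. The digits `dig` form the candidate `T` for the remoteness, where
the digits that are not yet determined are marked by `opn`; the digits `bud` form the number of
stones that are still available, and the digits `new` its tentative new value. -/
structure Cell where
  opn : Bool
  dig : Bool
  bud : Bool
  new : Bool
  deriving DecidableEq, Fintype, Inhabited

/-- The alphabets of the stacks. -/
abbrev Alph : Stk → Type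
  | .inp => Γ'
  | .sav => Γ'
  | .lo => Cell
  | .hi => Cell
  | .out => Bool

/-- The Boolean registers. -/
structure Reg where
  first : Bool
  carry : Bool
  borrow : Bool
  odd : Bool
  seen : Bool
  any : Bool
  all : Bool
  fail : Bool
  parity : Bool
  big : Bool
  ok : Bool
  mark : Bool
  found : Bool
  pos : Bool
  last : Bool
  deriving Inhabited

noncomputable instance : Fintype Reg :=
  .ofInjective (fun r => (r.first, r.carry, r.borrow, r.odd, r.seen, r.any, r.all, r.fail,
    r.parity, r.big, r.ok, r.mark, r.found, r.pos, r.last)) <| by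
  rintro ⟨⟩ ⟨⟩ h
  simpa only [Prod.mk.injEq, Reg.mk.injEq] using h

/-- The labels of the program. -/
inductive Label
  | start
  | init
  | rewind
  | addTwo
  | commit
  | subtract
  | test
  | advance
  | turn
  | emit
  | clean
  deriving DecidableEq

instance : Fintype Label :=
  ⟨{.start, .init, .rewind, .addTwo, .commit, .subtract, .test, .advance, .turn, .emit, .clean},
    by rintro (_ | _) <;> decide⟩

/-- The internal states: the registers and the symbols read most recently. -/
abbrev State := Reg × Option Cell × Option Γ'

/-- The internal state with the given registers and no symbol in memory. -/
abbrev Reg.state (r : Reg) : State := (r, none, none)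

abbrev Stm := TM2.Stmt Alph Label State

/-- Compute the digits of `T + 2`. -/
def addTwoStep (r : Reg) (c : Cell) : Reg × Cell :=
  ({ r with
      first := false
      parity := if r.first then c.dig else r.parity
      -- Adding two is an increment that starts at the second digit.
      carry := if r.first then true else c.dig && r.carry },
    { c with
      bud := c.dig ^^ (!r.first && r.carry)
      new := c.dig ^^ (!r.first && r.carry) })

/-- Compute the digits of `T - x` and subtract them, rounded up to an even number. -/
def subtractStep (r : Reg) (c : Cell) (x : Bool) : Reg × Cell :=
  let d := subDigit c.dig x r.carry
  -- Using the lowest digit of the difference also as the incoming borrow subtracts it twice, which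
  -- rounds the difference up to an even number.
  let b := if r.first then d else r.borrow
  ({ r with
      first := false
      carry := subBorrow c.dig x r.carry
      borrow := subBorrow c.bud d b
      odd := if r.first then d else r.odd },
    { c with new := subDigit c.bud d b })

/-- Replace the number of available stones by the tentative value, unless `T < x`. -/
def commitStep (r : Reg) (c : Cell) : Reg × Cell :=
  (r, { c with bud := if r.carry then c.bud else c.new })

/-- Test whether at least two stones are available. -/
def testStep (r : Reg) (c : Cell) : Reg × Cell :=
  ({ r with first := false, big := r.big || (!r.first && c.bud) }, c)

/-- Determine the current digit, and open the next one. -/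
def advanceStep (r : Reg) (c : Cell) : Reg × Cell :=
  if c.opn && c.dig then ({ r with mark := true }, { c with opn := false, dig := r.ok })
  else if c.opn && r.mark then ({ r with mark := false, found := true }, { c with dig := true })
  else (r, c)

/-- Update the flags after the treatment of a pile. -/
def Reg.endPile (r : Reg) : Reg :=
  { r with
    any := r.any || (r.odd && !r.carry)
    all := r.all && (r.odd && !r.carry)
    fail := r.fail || (!r.carry && r.borrow) }

/-- Evaluate the criterion. -/
def Reg.evaluate (r : Reg) : Reg :=
  { r with
    -- The budget left is `T + 2` minus twice the pairs needed: nonnegative means at most `T / 2 +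
    -- 1` pairs, at least two means at most `T / 2`.
    ok := !r.fail && (r.big || if r.parity then r.any else r.all)
    mark := false
    found := false }

/-- The pile digit read from the input. -/
def digitOf : Option Γ' → Bool
  | some (Γ'.bit b) => b
  | _ => false

/-- Whether the symbol ends a pile. -/
def endsPile : Option Γ' → Bool
  | some (Γ'.bit _) => false
  | _ => true

open TM2.Stmt

/-- Move the cells from one part of the working tape to the other one, with a transducer. -/
def sweep (back : Bool) (f : Reg → Cell → Reg × Cell) (l : Label) (exit : Stm) : Stm :=
  match back with
  | false =>
    pop .lo (fun v c => (v.1, c, none)) <|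
      branch (fun v => v.2.1.isSome)
        (push .hi (fun v => (f v.1 (v.2.1.getD default)).2) <|
          load (fun v => (f v.1 (v.2.1.getD default)).1.state) <| goto fun _ => l)
        exit
  | true =>
    pop .hi (fun v c => (v.1, c, none)) <|
      branch (fun v => v.2.1.isSome)
        (push .lo (fun v => (f v.1 (v.2.1.getD default)).2) <|
          load (fun v => (f v.1 (v.2.1.getD default)).1.state) <| goto fun _ => l)
        exit

/-- Go on with the next pile, if there is one. -/
def nextPile : Stm :=
  peek .inp (fun v s => (v.1, none, s)) <|
    branch (fun v => v.2.2.isSome)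
      (load (fun v => { v.1 with first := true, carry := false, seen := false }.state) <|
        goto fun _ => .subtract)
      (load (fun v => { v.1 with first := true, big := false }.state) <| goto fun _ => .test)

/-- The program. If `dec` holds, it decides whether the remoteness is even; otherwise it computes
the remoteness. -/
def program (dec : Bool) : Label → Stm
  | .start =>
    -- The top cell is closed with digit zero; it leaves room for `T + 2`.
    push .lo (fun _ => ⟨false, false, false, false⟩) <|
      load (fun v => { v.1 with first := true }.state) <| goto fun _ => .init
  | .init =>
    pop .inp (fun v s => (v.1, none, s)) <|
      branch (fun v => v.2.2.isSome)
        (push .sav (fun v => v.2.2.getD default) <|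
          push .lo (fun v => ⟨true, v.1.first, false, false⟩) <|
          load (fun v => { v.1 with first := false }.state) <| goto fun _ => .init)
        (goto fun _ => .rewind)
  | .rewind =>
    pop .sav (fun v s => (v.1, none, s)) <|
      branch (fun v => v.2.2.isSome)
        (push .inp (fun v => v.2.2.getD default) <|
          load (fun v => v.1.state) <| goto fun _ => .rewind)
        (load (fun v => { v.1 with first := true, any := false, all := true, fail := false }.state)
          <| goto fun _ => .addTwo)
  | .addTwo => sweep false addTwoStep .addTwo <| goto fun _ => .commit
  | .commit => sweep true commitStep .commit nextPile
  | .subtract =>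
    pop .lo (fun v c => (v.1, c, none)) <|
      branch (fun v => v.2.1.isSome)
        -- After its comma a pile is padded with zeros.
        (branch (fun v => v.1.seen)
          (push .hi (fun v => (subtractStep v.1 (v.2.1.getD default) false).2) <|
            load (fun v => (subtractStep v.1 (v.2.1.getD default) false).1.state) <|
            goto fun _ => .subtract)
          (pop .inp (fun v s => (v.1, v.2.1, s)) <|
            push .sav (fun v => v.2.2.getD default) <|
            push .hi (fun v => (subtractStep v.1 (v.2.1.getD default) (digitOf v.2.2)).2) <|
            load (fun v => { (subtractStep v.1 (v.2.1.getD default) (digitOf v.2.2)).1 with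
              seen := endsPile v.2.2 }.state) <|
            goto fun _ => .subtract))
        (load (fun v => v.1.endPile.state) <| goto fun _ => .commit)
  | .test =>
    sweep false testStep .test <| load (fun v => v.1.evaluate.state) <| goto fun _ => .advance
  | .advance =>
    sweep true advanceStep .advance <|
      branch (fun v => v.1.found) (goto fun _ => .rewind) (goto fun _ => .turn)
  | .turn =>
    sweep false Prod.mk .turn <|
      load (fun v => { v.1 with pos := false, last := false }.state) <| goto fun _ => .emit
  | .emit =>
    -- The most significant digit comes first: `pos` suppresses leading zeros, and `last` ends as
    -- the parity digit.
    pop .hi (fun v c => (v.1, c, none)) <|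
      branch (fun v => v.2.1.isSome)
        (load (fun v => ({ v.1 with
            pos := v.1.pos || (v.2.1.getD default).dig
            last := (v.2.1.getD default).dig }, none, none)) <|
          branch (fun v => !dec && v.1.pos)
            (push .out (fun v => v.1.last) <| goto fun _ => .emit)
            (goto fun _ => .emit))
        (branch (fun _ => dec)
          (push .out (fun v => !v.1.last) <| goto fun _ => .clean)
          (goto fun _ => .clean))
  | .clean =>
    pop .sav (fun v s => (v.1, none, s)) <|
      branch (fun v => v.2.2.isSome)
        (load (fun v => v.1.state) <| goto fun _ => .clean)
        (load (fun _ => (default : Reg).state) halt)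

/-- The machine that computes the remoteness, or decides whether it is even. -/
noncomputable def machine (dec : Bool) : FinTM2 where
  K := Stk
  k₀ := .inp
  k₁ := .out
  Γ := Alph
  Λ := Label
  main := .start
  σ := State
  initialState := (default : Reg).state
  Γk₀Fin := inferInstanceAs (Fintype Γ')
  m := program dec

/-- The contents of the stacks. -/
def stks (i s : List Γ') (p q : List Cell) (o : List Bool) : ∀ k, List (Alph k)
  | .inp => i
  | .sav => s
  | .lo => p
  | .hi => q
  | .out => o

section Stks

variable (i s : List Γ') (p q : List Cell) (o : List Bool)

@[simp] theorem stks_inp : stks i s p q o .inp = i := rfl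
@[simp] theorem stks_sav : stks i s p q o .sav = s := rfl
@[simp] theorem stks_lo : stks i s p q o .lo = p := rfl
@[simp] theorem stks_hi : stks i s p q o .hi = q := rfl
@[simp] theorem stks_out : stks i s p q o .out = o := rfl

@[simp] theorem update_inp (i' : List Γ') :
    Function.update (stks i s p q o) .inp i' = stks i' s p q o := by
  funext k; cases k <;> rfl

@[simp] theorem update_sav (s' : List Γ') :
    Function.update (stks i s p q o) .sav s' = stks i s' p q o := by
  funext k; cases k <;> rfl

@[simp] theorem update_lo (p' : List Cell) :
    Function.update (stks i s p q o) .lo p' = stks i s p' q o := by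
  funext k; cases k <;> rfl

@[simp] theorem update_hi (q' : List Cell) :
    Function.update (stks i s p q o) .hi q' = stks i s p q' o := by
  funext k; cases k <;> rfl

@[simp] theorem update_out (o' : List Bool) :
    Function.update (stks i s p q o) .out o' = stks i s p q o' := by
  funext k; cases k <;> rfl

end Stks

abbrev Config := TM2.Cfg Alph Label State

/-- The program reaches the configuration `c'` from `c` in at most `n` steps. -/
def RunsIn (dec : Bool) (n : ℕ) (c c' : Config) : Prop :=
  Nonempty (StateTransition.EvalsToInTime (TM2.step (program dec)) c (some c') n)

variable {dec : Bool}

/-! ### Runs of the individual routines -/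

theorem RunsIn.refl (c : Config) : RunsIn dec 0 c c := ⟨.refl _ _⟩

theorem RunsIn.mono {m n : ℕ} {c c' : Config} (h : RunsIn dec m c c') (hmn : m ≤ n) :
    RunsIn dec n c c' :=
  h.elim fun e => ⟨⟨e.toEvalsTo, e.steps_le_m.trans hmn⟩⟩

theorem RunsIn.trans {m n : ℕ} {a b c : Config} (h₁ : RunsIn dec m a b) (h₂ : RunsIn dec n b c) :
    RunsIn dec (m + n) a c :=
  h₁.elim fun e₁ => h₂.elim fun e₂ => by
    rw [add_comm]
    exact ⟨e₁.trans _ _ _ _ _ _ e₂⟩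

theorem RunsIn.step {a b : Config} (h : TM2.step (program dec) a = some b) : RunsIn dec 1 a b :=
  ⟨⟨⟨1, h⟩, le_rfl⟩⟩

/-- Apply a transducer to a list. -/
def transduce {R C D : Type*} (f : R → C → R × D) : R → List C → R × List D
  | r, [] => (r, [])
  | r, c :: l =>
    ((transduce f (f r c).1 l).1, (f r c).2 :: (transduce f (f r c).1 l).2)

/-- The stacks with the given contents of the working tape, where the roles of the two parts are
exchanged if `back` holds. -/
def tape (back : Bool) (i s : List Γ') (p q : List Cell) (o : List Bool) : ∀ k, List (Alph k) :=
  cond back (stks i s q p o) (stks i s p q o)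

/-- The code `exit` is executed within the step that finds the source stack empty, so the reached
configuration is given by `TM2.stepAux`. -/
theorem runsIn_sweep {back : Bool} {f : Reg → Cell → Reg × Cell} {l : Label} {exit : Stm}
    (hl : program dec l = sweep back f l exit) (r : Reg) (i s : List Γ') (p q : List Cell)
    (o : List Bool) :
    RunsIn dec (p.length + 1) ⟨some l, r.state, tape back i s p q o⟩
      (TM2.stepAux exit (transduce f r p).1.state
        (tape back i s [] ((transduce f r p).2.reverse ++ q) o)) := by
  induction p generalizing r q with
  | nil =>
    refine .step ?_
    rw [TM2.step, hl]
    cases back <;> simp [sweep, tape, transduce]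
  | cons c p ih =>
    have h1 : RunsIn dec 1 ⟨some l, r.state, tape back i s (c :: p) q o⟩
        ⟨some l, (f r c).1.state, tape back i s p ((f r c).2 :: q) o⟩ := by
      refine .step ?_
      rw [TM2.step, hl]
      cases back <;> simp [sweep, tape]
    have h2 := h1.trans (ih (f r c).1 ((f r c).2 :: q))
    simp only [transduce, List.reverse_cons, List.append_assoc, List.singleton_append]
    exact h2.mono (by simp; omega)

theorem runsIn_init (r : Reg) (i s : List Γ') (p : List Cell) (hr : r.first = false) :
    RunsIn dec (i.length + 1) ⟨some .init, r.state, stks i s p [] []⟩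
      ⟨some .rewind, r.state,
        stks [] (i.reverse ++ s) (List.replicate i.length ⟨true, false, false, false⟩ ++ p) [] []⟩ := by
  induction i generalizing s p with
  | nil => exact .step (by simp [program])
  | cons a i ih =>
    have h1 : RunsIn dec 1 ⟨some .init, r.state, stks (a :: i) s p [] []⟩
        ⟨some .init, r.state, stks i (a :: s) (⟨true, false, false, false⟩ :: p) [] []⟩ := by
      refine .step ?_
      cases r
      simp at hr
      simp [program, hr]
    have h2 := h1.trans (ih (a :: s) (⟨true, false, false, false⟩ :: p))
    have h3 : List.replicate (a :: i).length (⟨true, false, false, false⟩ : Cell) ++ p =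
        List.replicate i.length ⟨true, false, false, false⟩ ++ ⟨true, false, false, false⟩ :: p := by
      rw [List.length_cons, List.replicate_succ', List.append_assoc]; rfl
    rw [h3]
    simp only [List.reverse_cons, List.append_assoc, List.singleton_append]
    exact h2.mono (by simp; omega)

theorem runsIn_rewind (r : Reg) (i s : List Γ') (p : List Cell) :
    RunsIn dec (s.length + 1) ⟨some .rewind, r.state, stks i s p [] []⟩
      ⟨some .addTwo, { r with first := true, any := false, all := true, fail := false }.state,
        stks (s.reverse ++ i) [] p [] []⟩ := by
  induction s generalizing i with
  | nil => exact .step (by simp [program])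
  | cons a s ih =>
    have h1 : RunsIn dec 1 ⟨some .rewind, r.state, stks i (a :: s) p [] []⟩
        ⟨some .rewind, r.state, stks (a :: i) s p [] []⟩ := .step (by simp [program])
    have h2 := h1.trans (ih (a :: i))
    simp only [List.reverse_cons, List.append_assoc, List.singleton_append]
    exact h2.mono (by simp; omega)

theorem runsIn_clean (r : Reg) (s : List Γ') (o : List Bool) :
    RunsIn dec (s.length + 1) ⟨some .clean, r.state, stks [] s [] [] o⟩
      ⟨none, (default : Reg).state, stks [] [] [] [] o⟩ := by
  induction s with
  | nil => exact .step (by simp [program])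
  | cons a s ih =>
    have h1 : RunsIn dec 1 ⟨some .clean, r.state, stks [] (a :: s) [] [] o⟩
        ⟨some .clean, r.state, stks [] s [] [] o⟩ := .step (by simp [program])
    exact (h1.trans ih).mono (by simp; omega)

theorem runsIn_emit_nat (r : Reg) (s : List Γ') (q : List Cell) (o : List Bool)
    (hr : r.pos = !o.isEmpty) :
    ∃ r' : Reg, RunsIn false (q.length + 1) ⟨some .emit, r.state, stks [] s [] q o⟩
      ⟨some .clean, r'.state, stks [] s [] []
        ((q.map Cell.dig).foldl (fun out b => if b || !out.isEmpty then b :: out else out) o)⟩ := by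
  induction q generalizing r o with
  | nil => exact ⟨r, .step (by simp [program])⟩
  | cons c q ih =>
    have h1 : RunsIn false 1 ⟨some .emit, r.state, stks [] s [] (c :: q) o⟩
        ⟨some .emit, { r with pos := r.pos || c.dig, last := c.dig }.state,
          stks [] s [] q (if c.dig || !o.isEmpty then c.dig :: o else o)⟩ := by
      refine .step ?_
      rw [hr]
      cases hc : c.dig <;> cases ho : o <;> simp [program, hc, hr, ho]
    obtain ⟨r', h2⟩ := ih { r with pos := r.pos || c.dig, last := c.dig }
      (if c.dig || !o.isEmpty then c.dig :: o else o)
      (by rw [hr]; cases c.dig <;> cases o <;> simp)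
    exact ⟨r', (h1.trans h2).mono (by simp; omega)⟩

theorem runsIn_emit_dec (r : Reg) (s : List Γ') (q : List Cell) (o : List Bool) :
    ∃ r' : Reg, RunsIn true (q.length + 1) ⟨some .emit, r.state, stks [] s [] q o⟩
      ⟨some .clean, r'.state, stks [] s [] []
        ((!(q.map Cell.dig).foldl (fun _ b => b) r.last) :: o)⟩ := by
  induction q generalizing r with
  | nil => exact ⟨r, .step (by simp [program])⟩
  | cons c q ih =>
    have h1 : RunsIn true 1 ⟨some .emit, r.state, stks [] s [] (c :: q) o⟩
        ⟨some .emit, { r with pos := r.pos || c.dig, last := c.dig }.state,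
          stks [] s [] q o⟩ := .step (by simp [program])
    obtain ⟨r', h2⟩ := ih { r with pos := r.pos || c.dig, last := c.dig }
    exact ⟨r', (h1.trans h2).mono (by simp; omega)⟩

/-- Subtract the pile with digits `xs`. -/
def subtractSweep : Reg → List Cell → List Bool → Reg × List Cell
  | r, [], _ => (r, [])
  | r, c :: l, xs =>
    ((subtractSweep (subtractStep r c (xs.headD false)).1 l xs.tail).1,
      (subtractStep r c (xs.headD false)).2 ::
        (subtractSweep (subtractStep r c (xs.headD false)).1 l xs.tail).2)

theorem runsIn_subtract_seen (r : Reg) (i s : List Γ') (p q : List Cell) (o : List Bool)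
    (hr : r.seen = true) :
    RunsIn dec (p.length + 1) ⟨some .subtract, r.state, stks i s p q o⟩
      ⟨some .commit, (subtractSweep r p []).1.endPile.state,
        stks i s [] ((subtractSweep r p []).2.reverse ++ q) o⟩ := by
  induction p generalizing r q with
  | nil => exact .step (by simp [program, subtractSweep])
  | cons c p ih =>
    have h1 : RunsIn dec 1 ⟨some .subtract, r.state, stks i s (c :: p) q o⟩
        ⟨some .subtract, (subtractStep r c false).1.state,
          stks i s p ((subtractStep r c false).2 :: q) o⟩ := .step (by simp [program, hr])
    have h2 := h1.trans (ih (subtractStep r c false).1 ((subtractStep r c false).2 :: q) hr)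
    simp only [subtractSweep, List.reverse_cons, List.append_assoc, List.singleton_append]
    exact h2.mono (by simp; omega)

/-- The arithmetic ignores `seen`, so the moment at which the comma sets it does not matter. -/
theorem subtractSweep_seen (r : Reg) (p : List Cell) (xs : List Bool) (b : Bool) :
    subtractSweep { r with seen := b } p xs =
      ({ (subtractSweep r p xs).1 with seen := b }, (subtractSweep r p xs).2) := by
  induction p generalizing r xs with
  | nil => rfl
  | cons c p ih =>
    simp only [subtractSweep]
    rw [show (subtractStep { r with seen := b } c (xs.headD false)) =
      ({ (subtractStep r c (xs.headD false)).1 with seen := b },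
        (subtractStep r c (xs.headD false)).2) from rfl, ih]

/-- The inequality is strict because the comma is read together with a cell of its own, with pile
digit zero. -/
theorem runsIn_subtract (r : Reg) (i s : List Γ') (p q : List Cell) (o : List Bool)
    (xs : List Bool) (hxs : xs.length < p.length) (hr : r.seen = false) :
    RunsIn dec (p.length + 1)
      ⟨some .subtract, r.state, stks (xs.map Γ'.bit ++ Γ'.comma :: i) s p q o⟩
      ⟨some .commit, { (subtractSweep r p xs).1 with seen := true }.endPile.state,
        stks i (Γ'.comma :: ((xs.map Γ'.bit).reverse ++ s)) []
          ((subtractSweep r p xs).2.reverse ++ q) o⟩ := by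
  induction p generalizing r s q xs with
  | nil => simp at hxs
  | cons c p ih =>
    cases xs with
    | nil =>
      have h1 : RunsIn dec 1 ⟨some .subtract, r.state, stks (Γ'.comma :: i) s (c :: p) q o⟩
          ⟨some .subtract, { (subtractStep r c false).1 with seen := true }.state,
            stks i (Γ'.comma :: s) p ((subtractStep r c false).2 :: q) o⟩ :=
        .step (by simp [program, hr, digitOf, endsPile])
      have h2 := h1.trans (runsIn_subtract_seen _ i (Γ'.comma :: s) p
        ((subtractStep r c false).2 :: q) o rfl)
      rw [subtractSweep_seen] at h2
      simp only [subtractSweep, List.reverse_cons, List.append_assoc, List.singleton_append]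
      exact h2.mono (by simp; omega)
    | cons x xs =>
      have h1 : RunsIn dec 1
          ⟨some .subtract, r.state, stks ((x :: xs).map Γ'.bit ++ Γ'.comma :: i) s (c :: p) q o⟩
          ⟨some .subtract, (subtractStep r c x).1.state,
            stks (xs.map Γ'.bit ++ Γ'.comma :: i) (Γ'.bit x :: s) p
              ((subtractStep r c x).2 :: q) o⟩ := by
        refine .step ?_
        simp [program, hr, digitOf, endsPile, subtractStep]
      have h2 := h1.trans (ih (subtractStep r c x).1 (Γ'.bit x :: s)
        ((subtractStep r c x).2 :: q) xs (by simpa using hxs) hr)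
      simp only [subtractSweep, List.reverse_cons, List.append_assoc, List.singleton_append,
        List.map_cons]
      exact h2.mono (by simp; omega)

end NimMachine

namespace NimMachine

/-! ### The transducers -/

/-- The digits of a list of cells, and whether they are open. -/
def shape (l : List Cell) : List (Bool × Bool) := l.map fun c => (c.opn, c.dig)

/-- The number formed by the digits `dig`. -/
def digVal (l : List Cell) : ℕ := bitsVal (l.map Cell.dig)

/-- The number formed by the digits `bud`. -/
def budVal (l : List Cell) : ℕ := bitsVal (l.map Cell.bud)

/-- The number formed by the digits `new`. -/
def newVal (l : List Cell) : ℕ := bitsVal (l.map Cell.new)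

theorem digVal_eq_shape (l : List Cell) : digVal l = bitsVal ((shape l).map Prod.snd) := by
  simp [digVal, shape, Function.comp_def]

theorem length_shape (l : List Cell) : (shape l).length = l.length := by simp [shape]

theorem transduce_append {R C D : Type*} (f : R → C → R × D) (r : R) (l l' : List C) :
    transduce f r (l ++ l') =
      ((transduce f (transduce f r l).1 l').1,
        (transduce f r l).2 ++ (transduce f (transduce f r l).1 l').2) := by
  induction l generalizing r with
  | nil => rfl
  | cons c l ih => simp [transduce, ih]

theorem transduce_addTwo_tail (r : Reg) (hr : r.first = false) (l : List Cell) :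
    ∃ ca, (transduce addTwoStep r l).1 = { r with carry := ca } ∧
      shape (transduce addTwoStep r l).2 = shape l ∧
      (transduce addTwoStep r l).2.map Cell.new = (transduce addTwoStep r l).2.map Cell.bud ∧
      budVal (transduce addTwoStep r l).2 + 2 ^ l.length * ca.toNat =
        digVal l + r.carry.toNat := by
  induction l generalizing r with
  | nil => exact ⟨r.carry, rfl, rfl, rfl, by simp [transduce, budVal, digVal, bitsVal]⟩
  | cons c l ih =>
    obtain ⟨ca, h1, h2, h3, h4⟩ := ih (addTwoStep r c).1 rfl
    refine ⟨ca, ?_, ?_, ?_, ?_⟩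
    · simp only [transduce, h1]
      simp [addTwoStep, hr]
    · simp only [transduce, shape, List.map_cons] at h2 ⊢
      rw [h2]
      rfl
    · simp only [transduce, List.map_cons, h3]
      rfl
    · simp only [transduce, budVal, digVal, List.map_cons, bitsVal, List.length_cons,
        pow_succ] at h4 ⊢
      have h5 : (addTwoStep r c).2.bud.toNat + 2 * (addTwoStep r c).1.carry.toNat =
          c.dig.toNat + r.carry.toNat := by
        simp only [addTwoStep, hr]
        cases c.dig <;> cases r.carry <;> rfl
      linarith

/-- The final carry is left unspecified; since `new` agrees with `bud`, the commit that follows is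
harmless either way. -/
theorem transduce_addTwo (r : Reg) (hr : r.first = true) (l : List Cell) (hl : l ≠ [])
    (hlt : digVal l + 2 < 2 ^ l.length) :
    ∃ ca, (transduce addTwoStep r l).1 =
        { r with first := false, parity := decide (digVal l % 2 = 1), carry := ca } ∧
      shape (transduce addTwoStep r l).2 = shape l ∧
      (transduce addTwoStep r l).2.map Cell.new = (transduce addTwoStep r l).2.map Cell.bud ∧
      budVal (transduce addTwoStep r l).2 = digVal l + 2 := by
  cases l with
  | nil => exact absurd rfl hl
  | cons c l =>
    obtain ⟨ca, h1, h2, h3, h4⟩ := transduce_addTwo_tail (addTwoStep r c).1 rfl l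
    refine ⟨ca, ?_, ?_, ?_, ?_⟩
    · simp only [transduce, h1]
      simp only [addTwoStep, hr, digVal, List.map_cons, bitsVal]
      congr 1
      cases c.dig <;> simp [Nat.add_mod]
    · simp only [transduce, shape, List.map_cons] at h2 ⊢
      rw [h2]
      rfl
    · simp only [transduce, List.map_cons, h3]
      rfl
    · simp only [transduce, budVal, digVal, List.map_cons, bitsVal, List.length_cons,
        pow_succ] at h4 hlt ⊢
      simp only [addTwoStep, hr] at h4 ⊢
      simp only [Bool.not_true, Bool.false_and, Bool.xor_false, if_true, Bool.toNat_true] at h4 ⊢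
      -- A carry out of the last cell is excluded by `hlt`.
      cases ca
      · simp only [Bool.toNat_false] at h4
        omega
      · simp only [Bool.toNat_true] at h4
        omega

theorem transduce_commit (r : Reg) (l : List Cell) :
    transduce commitStep r l =
      (r, l.map fun c => { c with bud := if r.carry then c.bud else c.new }) := by
  induction l with
  | nil => rfl
  | cons c l ih =>
    simp only [transduce, commitStep, List.map_cons]
    rw [show transduce commitStep r l = _ from ih]

theorem transduce_mk (r : Reg) (l : List Cell) : transduce Prod.mk r l = (r, l) := by
  induction l with
  | nil => rfl
  | cons c l ih => simp [transduce, ih]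

theorem transduce_test_tail (r : Reg) (hr : r.first = false) (l : List Cell) :
    transduce testStep r l = ({ r with big := r.big || decide (0 < budVal l) }, l) := by
  induction l generalizing r with
  | nil => simp [transduce, budVal, bitsVal]
  | cons c l ih =>
    simp only [transduce, ih (testStep r c).1 rfl]
    rw [show budVal (c :: l) = c.bud.toNat + 2 * budVal l from rfl]
    simp only [testStep, hr]
    cases c.bud <;> simp

theorem transduce_test (r : Reg) (hr : r.first = true) (hb : r.big = false) (l : List Cell)
    (hl : l ≠ []) :
    transduce testStep r l = ({ r with first := false, big := decide (2 ≤ budVal l) }, l) := by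
  cases l with
  | nil => exact absurd rfl hl
  | cons c l =>
    simp only [transduce, transduce_test_tail (testStep r c).1 rfl]
    rw [show budVal (c :: l) = c.bud.toNat + 2 * budVal l from rfl]
    simp only [testStep, hr, hb, Prod.mk.injEq, and_true]
    congr 1
    have := Bool.toNat_le c.bud
    simp only [Bool.false_or, Bool.not_true, Bool.false_and, decide_eq_decide]
    omega

theorem transduce_advance_closed (r : Reg) (l : List Cell) (hl : ∀ c ∈ l, c.opn = false) :
    transduce advanceStep r l = (r, l) := by
  induction l with
  | nil => rfl
  | cons c l ih =>
    have h : advanceStep r c = (r, c) := by simp [advanceStep, hl c (by simp)]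
    simp [transduce, h, ih fun c hc => hl c (by simp [hc])]

theorem transduce_advance_open (r : Reg) (l : List Cell) (hr : r.mark = false)
    (hl : ∀ c ∈ l, c.dig = false) : transduce advanceStep r l = (r, l) := by
  induction l with
  | nil => rfl
  | cons c l ih =>
    have h : advanceStep r c = (r, c) := by simp [advanceStep, hl c (by simp), hr]
    simp [transduce, h, ih fun c hc => hl c (by simp [hc])]

/-- The shape of a working tape with the digits `h` determined and `p` digits open, of which the
most significant one has been set tentatively. -/
def openShape (h : List Bool) : ℕ → List (Bool × Bool)
  | 0 => h.map (Prod.mk false)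
  | p + 1 => List.replicate p (true, false) ++ (true, true) :: h.map (Prod.mk false)

/-- Read from the most significant cell, the tentative digit is the first open one. Closing it sets
`mark`, which makes the next cell tentative; if no cell remains, `found` stays false and the search
ends. -/
theorem transduce_advance (r : Reg) (hf : r.found = false) (l : List Cell)
    (p : ℕ) (h : List Bool)
    (hl : shape l = openShape h (p + 1)) :
    (transduce advanceStep r l.reverse).1.found = decide (0 < p) ∧
      shape (transduce advanceStep r l.reverse).2.reverse = openShape (r.ok :: h) p := by
  unfold shape openShape at hl
  rw [List.map_eq_append_iff] at hl
  obtain ⟨us, cs, rfl, hus, hcs⟩ := hl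
  rw [List.map_eq_cons_iff] at hcs
  obtain ⟨c, hs, rfl, hc, hhs⟩ := hcs
  have hclosed : ∀ c ∈ hs.reverse, c.opn = false := by
    intro c hc
    have : (c.opn, c.dig) ∈ h.map (Prod.mk false) := by
      rw [← hhs]
      exact List.mem_map_of_mem (f := fun c : Cell => (c.opn, c.dig)) (List.mem_reverse.1 hc)
    obtain ⟨b, -, hb⟩ := List.mem_map.1 this
    exact (congrArg Prod.fst hb).symm
  have hundet : ∀ c ∈ us, c.opn = true ∧ c.dig = false := by
    intro c hc
    have : (c.opn, c.dig) ∈ List.replicate p (true, false) := by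
      rw [← hus]
      exact List.mem_map_of_mem (f := fun c : Cell => (c.opn, c.dig)) hc
    simpa using List.eq_of_mem_replicate this
  have hc1 : c.opn = true := congrArg Prod.fst hc
  have hc2 : c.dig = true := congrArg Prod.snd hc
  have hstep : advanceStep r c = ({ r with mark := true }, { c with opn := false, dig := r.ok }) := by
    simp [advanceStep, hc1, hc2]
  rw [List.reverse_append, List.reverse_cons, List.append_assoc, List.singleton_append,
    transduce_append, transduce_advance_closed r _ hclosed]
  simp only [transduce, hstep]
  cases p with
  | zero =>
    have : us = [] := by simpa using hus
    subst this
    simp [transduce, hf, shape, hhs, openShape]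
  | succ p =>
    rcases List.eq_nil_or_concat us with rfl | ⟨vs, v, rfl⟩
    · simp at hus
    have hv := hundet v (by simp)
    have hstep' : advanceStep { r with mark := true } v =
        ({ r with mark := false, found := true }, { v with dig := true }) := by
      simp [advanceStep, hv.1, hv.2]
    have hvs : ∀ c ∈ vs.reverse, c.dig = false := fun c hc => (hundet c (by simp_all)).2
    rw [List.concat_eq_append, List.map_append, List.replicate_succ'] at hus
    have hus' := (List.append_inj' hus rfl).1
    rw [List.concat_eq_append, List.reverse_append, List.reverse_singleton, List.singleton_append]
    simp only [transduce, hstep']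
    rw [transduce_advance_open _ _ rfl hvs]
    simp [shape, hus', hhs, hv.1, openShape]

/-! ### Subtraction of a pile -/

/-- Two subtractors run in tandem: `d` is formed by the digits of the first difference, which the
second consumes as they appear. Both equations sum up `toNat_sub` over the cells, with the outgoing
borrows as correction terms. -/
theorem subtractSweep_tail (r : Reg) (hr : r.first = false) (l : List Cell) (xs : List Bool)
    (hxs : xs.length ≤ l.length) :
    ∃ ca bo d, (subtractSweep r l xs).1 = { r with carry := ca, borrow := bo } ∧
      shape (subtractSweep r l xs).2 = shape l ∧
      (subtractSweep r l xs).2.map Cell.bud = l.map Cell.bud ∧ d < 2 ^ l.length ∧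
      digVal l + 2 ^ l.length * ca.toNat = bitsVal xs + r.carry.toNat + d ∧
      budVal l + 2 ^ l.length * bo.toNat =
        d + r.borrow.toNat + newVal (subtractSweep r l xs).2 := by
  induction l generalizing r xs with
  | nil =>
    have : xs = [] := by simpa using hxs
    subst this
    exact ⟨r.carry, r.borrow, 0, rfl, rfl, rfl, by simp, by simp [digVal, bitsVal],
      by simp [subtractSweep, budVal, newVal, bitsVal]⟩
  | cons c l ih =>
    obtain ⟨ca, bo, d, h1, h2, h3, h4, h5, h6⟩ := ih (subtractStep r c (xs.headD false)).1 rfl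
      xs.tail (by simp at hxs ⊢; omega)
    have e1 := toNat_sub c.dig (xs.headD false) r.carry
    have e2 := toNat_sub c.bud (subDigit c.dig (xs.headD false) r.carry) r.borrow
    have e3 : bitsVal xs = (xs.headD false).toNat + 2 * bitsVal xs.tail := by
      cases xs <;> simp [bitsVal]
    refine ⟨ca, bo, (subDigit c.dig (xs.headD false) r.carry).toNat + 2 * d, ?_, ?_, ?_, ?_, ?_, ?_⟩
    · simp only [subtractSweep, h1]
      simp [subtractStep, hr]
    · simp only [subtractSweep, shape, List.map_cons] at h2 ⊢
      rw [h2]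
      rfl
    · simp only [subtractSweep, List.map_cons, h3]
      rfl
    · have := Bool.toNat_le (subDigit c.dig (xs.headD false) r.carry)
      rw [List.length_cons, pow_succ]
      omega
    · simp only [digVal, List.map_cons, bitsVal, List.length_cons, pow_succ] at h5 ⊢
      simp only [subtractStep] at h5
      rw [e3]
      linarith
    · simp only [budVal, newVal, subtractSweep, List.map_cons, bitsVal, List.length_cons,
        pow_succ] at h6 ⊢
      simp only [subtractStep, hr, Bool.false_eq_true, if_false] at h6 ⊢
      linarith

theorem subtractSweep_spec (r : Reg) (hr : r.first = true) (hca : r.carry = false) (l : List Cell)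
    (hl : l ≠ []) (xs : List Bool) (hxs : xs.length ≤ l.length) :
    ∃ bo, (subtractSweep r l xs).1 =
        { r with
          first := false
          carry := decide (digVal l < bitsVal xs)
          borrow := bo
          odd := decide (bitsVal xs % 2 ≠ digVal l % 2) } ∧
      shape (subtractSweep r l xs).2 = shape l ∧
      (subtractSweep r l xs).2.map Cell.bud = l.map Cell.bud ∧
      (bitsVal xs ≤ digVal l →
        bo = decide (budVal l < 2 * ((digVal l - bitsVal xs + 1) / 2)) ∧
        (bo = false → newVal (subtractSweep r l xs).2 + 2 * ((digVal l - bitsVal xs + 1) / 2) =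
          budVal l)) := by
  cases l with
  | nil => exact absurd rfl hl
  | cons c l =>
    obtain ⟨ca, bo, d, h1, h2, h3, h4, h5, h6⟩ :=
      subtractSweep_tail (subtractStep r c (xs.headD false)).1 rfl l xs.tail
        (by simp at hxs ⊢; omega)
    have e1 := toNat_sub c.dig (xs.headD false) r.carry
    have e3 : bitsVal xs = (xs.headD false).toNat + 2 * bitsVal xs.tail := by
      cases xs <;> simp [bitsVal]
    obtain ⟨x, hx⟩ : ∃ x, x = xs.headD false := ⟨_, rfl⟩
    rw [← hx] at h1 h2 h3 h5 h6 e1 e3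
    have e4 : digVal (c :: l) = c.dig.toNat + 2 * digVal l := rfl
    have e5 : budVal (c :: l) = c.bud.toNat + 2 * budVal l := rfl
    obtain ⟨D, hD⟩ : ∃ D, D = subDigit c.dig x r.carry := ⟨_, rfl⟩
    have e6 : newVal (subtractSweep r (c :: l) xs).2 = (subDigit c.bud D D).toNat + 2 *
        newVal (subtractSweep (subtractStep r c (xs.headD false)).1 l xs.tail).2 := by
      simp only [subtractSweep, newVal, List.map_cons, bitsVal]
      simp only [subtractStep, hr, if_true, ← hx, ← hD]
    rw [← hx] at e6
    have hn : newVal (subtractSweep (subtractStep r c x).1 l xs.tail).2 < 2 ^ l.length := by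
      have := bitsVal_lt ((subtractSweep (subtractStep r c x).1 l xs.tail).2.map Cell.new)
      rwa [List.length_map, ← length_shape, h2, length_shape] at this
    have hd : (subtractStep r c x).1.carry = subBorrow c.dig x false := by
      simp only [subtractStep, hca]
    have hb : (subtractStep r c x).1.borrow = subBorrow c.bud D D := by
      simp only [subtractStep, hr, if_true, ← hD]
    rw [hd] at h5
    rw [hb] at h6
    rw [hca] at e1 hD
    -- Taking `D` twice from the lowest cell leaves its digit unchanged and borrows `D` from the
    -- next cell.
    have e7 : (subBorrow c.bud D D) = D := by cases c.bud <;> cases D <;> rfl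
    have e8 : (subDigit c.bud D D) = c.bud := by cases c.bud <;> cases D <;> rfl
    rw [e7] at h6
    rw [e8] at e6
    rw [← hD] at e1
    have hT := bitsVal_lt (l.map Cell.dig)
    have hB := bitsVal_lt (l.map Cell.bud)
    rw [List.length_map] at hT hB
    change digVal l < _ at hT
    change budVal l < _ at hB
    have hD1 := Bool.toNat_le D
    have hb1 := Bool.toNat_le c.bud
    have hca' : ca = decide (digVal (c :: l) < bitsVal xs) := by
      rw [e3, e4]
      cases ca
      · simp only [Bool.toNat_false] at h5 e1
        symm
        rw [decide_eq_false_iff_not]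
        omega
      · simp only [Bool.toNat_true, Bool.toNat_false] at h5 e1
        symm
        rw [decide_eq_true_iff]
        omega
    have hodd : D = decide (bitsVal xs % 2 ≠ digVal (c :: l) % 2) := by
      rw [e3, e4, hD]
      cases x <;> cases c.dig <;> simp [subDigit, Nat.add_mod]
    refine ⟨bo, ?_, ?_, ?_, ?_⟩
    · simp only [subtractSweep, ← hx, h1]
      rw [← hodd, ← hca', hD]
      simp [subtractStep, hr, hca]
    · simp only [subtractSweep, ← hx, shape, List.map_cons] at h2 ⊢
      rw [h2]
      rfl
    · simp only [subtractSweep, ← hx, List.map_cons, h3]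
      rfl
    · intro hle
      -- The difference is `D + 2 * d`, and rounding it up to an even number gives `2 * (D + d)`.
      have hdec : 2 * ((digVal (c :: l) - bitsVal xs + 1) / 2) = 2 * (D.toNat + d) := by
        cases ca
        · simp only [Bool.toNat_false] at h5 e1
          omega
        · simp only [Bool.toNat_true, Bool.toNat_false] at h5 e1
          omega
      rw [hdec, e5, e6]
      cases bo
      · simp only [Bool.toNat_false] at h6
        refine ⟨?_, fun _ => by omega⟩
        symm
        rw [decide_eq_false_iff_not]
        omega
      · simp only [Bool.toNat_true] at h6
        refine ⟨?_, fun h => by simp at h⟩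
        symm
        rw [decide_eq_true_iff]
        omega

end NimMachine

namespace NimMachine

variable {dec : Bool}

/-! ### The evaluation of the criterion -/

theorem length_eq_of_shape_eq {l l' : List Cell} (h : shape l = shape l') :
    l.length = l'.length := by
  rw [← length_shape, h, length_shape]

theorem digVal_eq_of_shape_eq {l l' : List Cell} (h : shape l = shape l') :
    digVal l = digVal l' := by
  rw [digVal_eq_shape, h, ← digVal_eq_shape]

/-- The encoding of a list of piles. -/
def encPiles (L : List (List Bool)) : List Γ' :=
  L.flatMap fun xs => xs.map Γ'.bit ++ [Γ'.comma]

theorem encPiles_cons (xs : List Bool) (L : List (List Bool)) :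
    encPiles (xs :: L) = xs.map Γ'.bit ++ Γ'.comma :: encPiles L := by
  simp [encPiles]

theorem length_encPiles_cons (xs : List Bool) (L : List (List Bool)) :
    (encPiles (xs :: L)).length = xs.length + 1 + (encPiles L).length := by
  simp [encPiles_cons]
  omega

theorem length_le_encPiles (L : List (List Bool)) : L.length ≤ (encPiles L).length := by
  induction L with
  | nil => simp
  | cons xs L ih =>
    rw [length_encPiles_cons, List.length_cons]
    omega

theorem length_le_encPiles_of_mem {L : List (List Bool)} {xs : List Bool} (h : xs ∈ L) :
    xs.length ≤ (encPiles L).length := by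
  induction L with
  | nil => simp at h
  | cons ys L ih =>
    rw [length_encPiles_cons]
    rcases List.mem_cons.1 h with rfl | h
    · omega
    · have := ih h
      omega

/-- The comma after each pile supplies the extra digit that the addition of its number may need. -/
theorem sum_bitsVal_lt (L : List (List Bool)) :
    (L.map bitsVal).sum < 2 ^ (encPiles L).length := by
  induction L with
  | nil => simp [encPiles]
  | cons xs L ih =>
    rw [length_encPiles_cons, List.map_cons, List.sum_cons]
    have h1 := bitsVal_lt xs
    have h2 : 2 ^ xs.length ≤ 2 ^ (xs.length + (encPiles L).length) :=
      Nat.pow_le_pow_right (by omega) (by omega)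
    have h3 : 2 ^ (encPiles L).length ≤ 2 ^ (xs.length + (encPiles L).length) :=
      Nat.pow_le_pow_right (by omega) (by omega)
    rw [show xs.length + 1 + (encPiles L).length = xs.length + (encPiles L).length + 1 by omega,
      pow_succ]
    omega

/-- The pile has less than `T` stones, and the difference is odd. -/
def oddBelow (T : ℕ) (xs : List Bool) : Bool :=
  decide (bitsVal xs % 2 ≠ T % 2) && !decide (T < bitsVal xs)

/-- The number of stones that a pile requires. -/
def cost (T : ℕ) (xs : List Bool) : ℕ := 2 * ((T - bitsVal xs + 1) / 2)

/-- The criterion for a list of piles. -/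
def lastsBits (L : List (List Bool)) (T : ℕ) : Bool :=
  !decide (T + 2 < (L.map (cost T)).sum) &&
    (decide (2 ≤ T + 2 - (L.map (cost T)).sum) ||
      if decide (T % 2 = 1) then L.any (oddBelow T) else L.all (oddBelow T))

/-- The configuration before the treatment of the next pile. -/
def pileConfig (r : Reg) (i s : List Γ') (l : List Cell) : Config :=
  TM2.stepAux nextPile r.state (stks i s l [] [])

theorem pileConfig_nil (r : Reg) (s : List Γ') (l : List Cell) :
    pileConfig r [] s l =
      ⟨some .test, { r with first := true, big := false }.state, stks [] s l [] []⟩ := by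
  simp [pileConfig, nextPile]

theorem pileConfig_of_ne_nil (r : Reg) {i : List Γ'} (hi : i ≠ []) (s : List Γ')
    (l : List Cell) :
    pileConfig r i s l =
      ⟨some .subtract, { r with first := true, carry := false, seen := false }.state,
        stks i s l [] []⟩ := by
  cases i with
  | nil => exact absurd rfl hi
  | cons a i => simp [pileConfig, nextPile]

theorem runsIn_commit (r : Reg) (i s : List Γ') (l : List Cell) :
    RunsIn dec (l.length + 1) ⟨some .commit, r.state, stks i s [] l.reverse []⟩
      (pileConfig r i s
        (l.map fun c => { c with bud := if r.carry then c.bud else c.new })) := by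
  have h := runsIn_sweep (dec := dec) (back := true) (f := commitStep) (l := .commit)
    (exit := nextPile) rfl r i s l.reverse [] []
  rw [transduce_commit] at h
  simpa [tape, pileConfig] using h

/-- A final carry means that the pile exceeds `T`. Then its cost is zero, and the commit discards
the wrapped difference. -/
theorem runsIn_pile (r : Reg) (i s : List Γ') (l : List Cell) (xs : List Bool)
    (hxs : xs.length < l.length) :
    ∃ r' l', RunsIn dec (2 * (l.length + 1)) (pileConfig r (xs.map Γ'.bit ++ Γ'.comma :: i) s l)
        (pileConfig r' i ((xs.map Γ'.bit ++ [Γ'.comma]).reverse ++ s) l') ∧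
      shape l' = shape l ∧ r'.parity = r.parity ∧
      r'.any = (r.any || oddBelow (digVal l) xs) ∧ r'.all = (r.all && oddBelow (digVal l) xs) ∧
      r'.fail = (r.fail || decide (budVal l < cost (digVal l) xs)) ∧
      (r'.fail = false → budVal l' + cost (digVal l) xs = budVal l) := by
  have hl : l ≠ [] := by rintro rfl; simp at hxs
  rw [pileConfig_of_ne_nil r (by simp)]
  have h1 := runsIn_subtract (dec := dec) { r with first := true, carry := false, seen := false }
    i s l [] [] xs hxs rfl
  obtain ⟨bo, e1, e2, e3, e4⟩ := subtractSweep_spec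
    { r with first := true, carry := false, seen := false } rfl rfl l hl xs hxs.le
  rw [e1, List.append_nil] at h1
  have h2 := runsIn_commit (dec := dec)
    ({ r with
        first := false
        carry := decide (digVal l < bitsVal xs)
        borrow := bo
        odd := decide (bitsVal xs % 2 ≠ digVal l % 2)
        seen := true : Reg }.endPile) i (Γ'.comma :: ((xs.map Γ'.bit).reverse ++ s))
    (subtractSweep { r with first := true, carry := false, seen := false } l xs).2
  have hlen := length_eq_of_shape_eq e2
  have h3 := (h1.trans h2).mono (n := 2 * (l.length + 1)) (by omega)
  rw [show (xs.map Γ'.bit ++ [Γ'.comma]).reverse ++ s =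
    Γ'.comma :: ((xs.map Γ'.bit).reverse ++ s) by simp]
  refine ⟨_, _, h3, ?_, rfl, rfl, rfl, ?_, ?_⟩
  · rw [← e2]
    simp [shape]
  · by_cases hlt : digVal l < bitsVal xs
    · have : cost (digVal l) xs = 0 := by unfold cost; omega
      simp [Reg.endPile, hlt, this]
    · rw [(e4 (by omega)).1]
      simp [Reg.endPile, hlt, cost]
      rfl
  · by_cases hlt : digVal l < bitsVal xs
    · have : cost (digVal l) xs = 0 := by unfold cost; omega
      intro _
      rw [this]
      simp only [Reg.endPile, hlt, budVal, ← e3, List.map_map]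
      simp [Function.comp_def]
    · simp only [Reg.endPile, hlt, decide_false, Bool.not_false, Bool.true_and,
        Bool.or_eq_false_iff]
      intro hf
      have := (e4 (by omega)).2 hf.2
      rw [cost, ← this]
      simp [budVal, newVal, Function.comp_def]

/-- The budget is meaningful only while `fail` is false. Once set, `fail` persists, in accordance
with the fact that further costs cannot decrease the sum. -/
theorem runsIn_piles (L : List (List Bool)) (r : Reg) (s : List Γ') (l : List Cell)
    (hL : ∀ xs ∈ L, xs.length < l.length) :
    ∃ r' l', RunsIn dec (L.length * (2 * (l.length + 1))) (pileConfig r (encPiles L) s l)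
        (pileConfig r' [] ((encPiles L).reverse ++ s) l') ∧
      shape l' = shape l ∧ r'.parity = r.parity ∧
      r'.any = (r.any || L.any (oddBelow (digVal l))) ∧
      r'.all = (r.all && L.all (oddBelow (digVal l))) ∧
      r'.fail = (r.fail || decide (budVal l < (L.map (cost (digVal l))).sum)) ∧
      (r'.fail = false → budVal l' + (L.map (cost (digVal l))).sum = budVal l) := by
  induction L generalizing r s l with
  | nil =>
    refine ⟨r, l, ?_, by simp⟩
    exact (RunsIn.refl _).mono (Nat.zero_le _)
  | cons xs L ih =>
    obtain ⟨r₁, l₁, h1, h2, h3, h4, h5, h6, h7⟩ :=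
      runsIn_pile (dec := dec) r (encPiles L) s l xs (hL xs (by simp))
    have hlen := length_eq_of_shape_eq h2
    have hdig := digVal_eq_of_shape_eq h2
    obtain ⟨r₂, l₂, g1, g2, g3, g4, g5, g6, g7⟩ :=
      ih r₁ ((xs.map Γ'.bit ++ [Γ'.comma]).reverse ++ s) l₁
        (fun ys hy => hlen ▸ hL ys (by simp [hy]))
    rw [hdig] at g4 g5 g6 g7
    refine ⟨r₂, l₂, ?_, g2.trans h2, g3.trans h3, ?_, ?_, ?_, ?_⟩
    · rw [encPiles_cons]
      have := h1.trans g1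
      rw [hlen] at this
      simp only [List.reverse_append, List.reverse_cons, List.append_assoc,
        List.reverse_nil, List.nil_append, List.cons_append] at this ⊢
      refine this.mono ?_
      rw [List.length_cons]
      apply le_of_eq
      ring
    · rw [g4, h4, List.any_cons, Bool.or_assoc]
    · rw [g5, h5, List.all_cons, Bool.and_assoc]
    · rw [g6, List.map_cons, List.sum_cons]
      cases hf : r₁.fail
      · have h8 := h7 hf
        rw [hf] at h6
        rw [(Bool.or_eq_false_iff.1 h6.symm).1]
        simp only [Bool.false_or, decide_eq_decide]
        omega
      · rw [hf] at h6
        symm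
        rw [Bool.true_or]
        rcases Bool.or_eq_true_iff.1 h6.symm with h8 | h8
        · rw [h8, Bool.true_or]
        · rw [decide_eq_true_iff] at h8
          rw [Bool.or_eq_true_iff, decide_eq_true_iff]
          omega
    · intro hf
      have h8 : r₁.fail = false := by
        rw [g6] at hf
        exact (Bool.or_eq_false_iff.1 hf).1
      have := h7 h8
      have := g7 hf
      rw [List.map_cons, List.sum_cons]
      omega

/-- The number of steps of a round. -/
def roundTime (m k n : ℕ) : ℕ := (k + 1) + 4 * (n + 1) + m * (2 * (n + 1))

/-! ### One round, and the binary search -/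

theorem digVal_openShape {l : List Cell} {h : List Bool} {p : ℕ}
    (hl : shape l = openShape h (p + 1)) : digVal l = 2 ^ p * (2 * bitsVal h + 1) := by
  rw [digVal_eq_shape, hl, openShape]
  simp [bitsVal_append, bitsVal_replicate_false, bitsVal, Function.comp_def]
  ring

theorem runsIn_round (L : List (List Bool)) (r : Reg) (l : List Cell) (h : List Bool) (p : ℕ)
    (hl : shape l = openShape h (p + 1)) (hT : digVal l + 2 < 2 ^ l.length)
    (hL : ∀ xs ∈ L, xs.length < l.length) :
    ∃ (r' : Reg) (l' : List Cell), shape l' = openShape (lastsBits L (digVal l) :: h) p ∧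
      RunsIn dec (roundTime L.length (encPiles L).length l.length)
        ⟨some .rewind, r.state, stks [] (encPiles L).reverse l [] []⟩
        ⟨some (if 0 < p then .rewind else .turn), r'.state,
          stks [] (encPiles L).reverse l' [] []⟩ := by
  have hnil : l ≠ [] := by
    rintro rfl
    simp at hT
  have s1 := runsIn_rewind (dec := dec) r [] (encPiles L).reverse l
  rw [List.reverse_reverse, List.append_nil, List.length_reverse] at s1
  obtain ⟨r₁, hr₁⟩ : ∃ r₁ : Reg, r₁ =
    { r with first := true, any := false, all := true, fail := false } := ⟨_, rfl⟩
  rw [← hr₁] at s1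
  have s2 := runsIn_sweep (dec := dec) (back := false) (f := addTwoStep) (l := .addTwo)
    (exit := .goto fun _ => .commit) rfl r₁ (encPiles L) [] l [] []
  obtain ⟨ca, a1, a2, a3, a4⟩ := transduce_addTwo r₁ (by rw [hr₁]) l hnil hT
  obtain ⟨l₂, hl₂⟩ : ∃ l₂, l₂ = (transduce addTwoStep r₁ l).2 := ⟨_, rfl⟩
  obtain ⟨r₂, hr₂⟩ : ∃ r₂, r₂ = (transduce addTwoStep r₁ l).1 := ⟨_, rfl⟩
  rw [← hl₂] at a2 a3 a4
  rw [← hr₂] at a1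
  rw [← hr₂, ← hl₂, List.append_nil] at s2
  have hlen₂ := length_eq_of_shape_eq a2
  have s3 := runsIn_commit (dec := dec) r₂ (encPiles L) [] l₂
  obtain ⟨l₃, hl₃⟩ : ∃ l₃ : List Cell, l₃ = l₂.map fun c =>
    { c with bud := if r₂.carry then c.bud else c.new } := ⟨_, rfl⟩
  rw [← hl₃] at s3
  have hbud₃ : budVal l₃ = budVal l₂ := by
    rw [hl₃]
    unfold budVal
    rw [List.map_map]
    split_ifs
    · rfl
    · rw [← a3]; rfl
  have hshape₃ : shape l₃ = shape l := by
    rw [← a2, hl₃]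
    simp [shape]
  have hlen₃ := length_eq_of_shape_eq hshape₃
  have hdig₃ := digVal_eq_of_shape_eq hshape₃
  obtain ⟨r₄, l₄, s4, b1, b2, b3, b4, b5, b6⟩ :=
    runsIn_piles (dec := dec) L r₂ [] l₃ (fun xs hx => hlen₃ ▸ hL xs hx)
  rw [hdig₃, hbud₃, a4] at b5 b6
  rw [hdig₃] at b3 b4
  rw [a1, hr₁] at b2 b3 b4 b5
  simp only [Bool.false_or, Bool.true_and] at b3 b4 b5
  rw [pileConfig_nil, List.append_nil] at s4
  have hshape₄ := b1.trans hshape₃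
  have hlen₄ := length_eq_of_shape_eq hshape₄
  have hnil₄ : l₄ ≠ [] := by
    rintro rfl
    exact hnil (List.eq_nil_of_length_eq_zero hlen₄.symm)
  have s5 := runsIn_sweep (dec := dec) (back := false) (f := testStep) (l := .test)
    (exit := .load (fun v => v.1.evaluate.state) <| .goto fun _ => .advance) rfl
    { r₄ with first := true, big := false } [] (encPiles L).reverse l₄ [] []
  rw [transduce_test _ rfl rfl l₄ hnil₄] at s5
  obtain ⟨r₅, hr₅⟩ : ∃ r₅ : Reg, r₅ =
    { r₄ with first := false, big := decide (2 ≤ budVal l₄) : Reg }.evaluate := ⟨_, rfl⟩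
  have hok : r₅.ok = lastsBits L (digVal l) := by
    rw [hr₅]
    simp only [Reg.evaluate, lastsBits, b2, b3, b4, b5]
    cases hf : r₄.fail
    · have h7 := b6 hf
      rw [hf] at b5
      rw [← b5]
      have : (2 ≤ budVal l₄) ↔ 2 ≤ digVal l + 2 - (L.map (cost (digVal l))).sum := by omega
      simp [this]
    · rw [hf] at b5
      rw [← b5]
      simp
  have s6 := runsIn_sweep (dec := dec) (back := true) (f := advanceStep) (l := .advance)
    (exit := .branch (fun v => v.1.found) (.goto fun _ => .rewind) (.goto fun _ => .turn)) rfl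
    r₅ [] (encPiles L).reverse l₄.reverse [] []
  obtain ⟨c1, c2⟩ := transduce_advance r₅ (by rw [hr₅]; rfl) l₄ p h (hshape₄.trans hl)
  refine ⟨(transduce advanceStep r₅ l₄.reverse).1,
    (transduce advanceStep r₅ l₄.reverse).2.reverse, by rw [c2, hok], ?_⟩
  have e2 : TM2.stepAux (.goto fun _ => Label.commit : Stm) r₂.state
      (tape false (encPiles L) [] [] l₂.reverse []) =
      (⟨some .commit, r₂.state, stks (encPiles L) [] [] l₂.reverse []⟩ : Config) := rfl
  have e5 : TM2.stepAux
      (.load (fun v : State => v.1.evaluate.state) <| .goto fun _ => Label.advance : Stm)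
      { r₄ with first := false, big := decide (2 ≤ budVal l₄) : Reg }.state
      (tape false [] (encPiles L).reverse [] (l₄.reverse ++ []) []) =
      (⟨some .advance, r₅.state, tape true [] (encPiles L).reverse l₄.reverse [] []⟩ : Config) := by
    rw [hr₅, List.append_nil]
    rfl
  have e6 : TM2.stepAux
      (.branch (fun v : State => v.1.found) (.goto fun _ => Label.rewind)
        (.goto fun _ => Label.turn) : Stm)
      (transduce advanceStep r₅ l₄.reverse).1.state
      (tape true [] (encPiles L).reverse []
        ((transduce advanceStep r₅ l₄.reverse).2.reverse ++ []) []) =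
      (⟨some (if 0 < p then .rewind else .turn), (transduce advanceStep r₅ l₄.reverse).1.state,
        stks [] (encPiles L).reverse (transduce advanceStep r₅ l₄.reverse).2.reverse [] []⟩ :
          Config) := by
    rw [List.append_nil]
    by_cases hp : 0 < p <;> simp [tape, c1, hp]
  rw [e2] at s2
  rw [e5] at s5
  rw [e6, List.length_reverse] at s6
  refine (((((s1.trans s2).trans s3).trans s4).trans s5).trans s6).mono ?_
  rw [roundTime, hlen₂, hlen₃, hlen₄]
  omega

/-- With the leading digits `h` fixed, `R` lies in the dyadic interval from `bitsVal h * 2 ^ (p +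
1)` up to the next multiple. The tentative digit makes `T` its midpoint, and the test decides which
half contains `R`. -/
theorem runsIn_search (L : List (List Bool)) (R : ℕ)
    (hR : ∀ T, lastsBits L T = decide (T ≤ R)) (n : ℕ)
    (hn : 2 ≤ n) (hL : ∀ xs ∈ L, xs.length < n) (p : ℕ) (r : Reg) (l : List Cell) (h : List Bool)
    (hlen : l.length = n) (hl : shape l = openShape h (p + 1))
    (h1 : bitsVal h * 2 ^ (p + 1) ≤ R) (h2 : R < (bitsVal h + 1) * 2 ^ (p + 1))
    (h3 : (bitsVal h + 1) * 2 ^ (p + 1) ≤ 2 ^ (n - 1)) :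
    ∃ (r' : Reg) (l' : List Cell), l' ≠ [] ∧ l'.length = n ∧ digVal l' = R ∧
      RunsIn dec ((p + 1) * roundTime L.length (encPiles L).length n)
        ⟨some .rewind, r.state, stks [] (encPiles L).reverse l [] []⟩
        ⟨some .turn, r'.state, stks [] (encPiles L).reverse l' [] []⟩ := by
  -- By `h3` the candidates are below `2 ^ (n - 1)`, and `2 ≤ 2 ^ (n - 1)`, so `T + 2` fits into `n`
  -- digits.
  have hpow : 2 ^ n = 2 * 2 ^ (n - 1) := by
    rw [← pow_succ', Nat.sub_add_cancel (by omega)]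
  have hpow2 : 2 ≤ 2 ^ (n - 1) := by
    calc 2 = 2 ^ 1 := rfl
      _ ≤ 2 ^ (n - 1) := Nat.pow_le_pow_right (by omega) (by omega)
  induction p generalizing r l h with
  | zero =>
    have hd := digVal_openShape hl
    obtain ⟨r', l', g1, g2⟩ := runsIn_round (dec := dec) L r l h 0 hl
      (by rw [hlen, hd]; omega) (by rwa [hlen])
    have hlen' : l'.length = n := by
      rw [← hlen, ← length_shape l', g1, ← length_shape l, hl]
      simp [openShape]
    refine ⟨r', l', ?_, hlen', ?_, ?_⟩
    · rintro rfl
      simp at hlen'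
      omega
    · rw [digVal_eq_shape, g1, hR]
      simp only [openShape, List.map_map, Function.comp_def, List.map_id', bitsVal]
      rw [hd]
      by_cases hle : 2 ^ 0 * (2 * bitsVal h + 1) ≤ R
      · simp only [hle, decide_true, Bool.toNat_true]
        omega
      · simp only [hle, decide_false, Bool.toNat_false]
        omega
    · rw [hlen] at g2
      simpa using g2
  | succ p ih =>
    have hd := digVal_openShape hl
    have hlt : digVal l < (bitsVal h + 1) * 2 ^ (p + 1 + 1) := by
      rw [hd, pow_succ 2 (p + 1)]
      have : 0 < 2 ^ (p + 1) := by positivity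
      nlinarith
    obtain ⟨r₁, l₁, g1, g2⟩ := runsIn_round (dec := dec) L r l h (p + 1) hl
      (by rw [hlen]; omega) (by rwa [hlen])
    have hlen₁ : l₁.length = n := by
      rw [← hlen, ← length_shape l₁, g1, ← length_shape l, hl]
      simp [openShape]
      omega
    have hb : (lastsBits L (digVal l)).toNat ≤ 1 := Bool.toNat_le _
    have hv : bitsVal (lastsBits L (digVal l) :: h) =
      (lastsBits L (digVal l)).toNat + 2 * bitsVal h := rfl
    have hkey : bitsVal (lastsBits L (digVal l) :: h) * 2 ^ (p + 1) ≤ R ∧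
        R < (bitsVal (lastsBits L (digVal l) :: h) + 1) * 2 ^ (p + 1) := by
      rw [hv, hR, hd]
      rw [pow_succ 2 (p + 1)] at h1 h2
      by_cases hle : 2 ^ (p + 1) * (2 * bitsVal h + 1) ≤ R
      · simp only [hle, decide_true, Bool.toNat_true]
        constructor <;> nlinarith
      · simp only [hle, decide_false, Bool.toNat_false]
        constructor <;> nlinarith
    obtain ⟨r', l', k1, k2, k3, k4⟩ := ih r₁ l₁ _ hlen₁ g1 hkey.1 hkey.2 (by
      refine le_trans ?_ h3
      rw [hv, pow_succ 2 (p + 1)]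
      nlinarith [Nat.zero_le (2 ^ (p + 1))])
    refine ⟨r', l', k1, k2, k3, ?_⟩
    rw [hlen] at g2
    simp only [Nat.succ_pos, if_true] at g2
    refine (g2.trans k4).mono (le_of_eq ?_)
    ring

end NimMachine

namespace NimMachine

/-! ### The machine computes the remoteness -/

/-- The output of the machine for the remoteness `R`. -/
def output (dec : Bool) (R : ℕ) : List Bool :=
  if dec then [decide (R % 2 = 0)] else encodeNat R

/-- The number of steps of the machine for inputs of length `N`. -/
noncomputable def timeBound : Polynomial ℕ := 2 * .X ^ 3 + 9 * .X ^ 2 + 13 * .X + 7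

theorem runsIn_turn {dec : Bool} (r : Reg) (s : List Γ') (l : List Cell) (hl : l ≠ []) :
    ∃ r' : Reg, RunsIn dec (2 * (l.length + 1)) ⟨some .turn, r.state, stks [] s l [] []⟩
      ⟨some .clean, r'.state, stks [] s [] [] (output dec (digVal l))⟩ := by
  have s1 := runsIn_sweep (dec := dec) (back := false) (f := Prod.mk) (l := .turn)
    (exit := .load (fun v => { v.1 with pos := false, last := false }.state) <|
      .goto fun _ => .emit) rfl r [] s l [] []
  rw [transduce_mk, List.append_nil] at s1
  have s1' : RunsIn dec (l.length + 1) ⟨some .turn, r.state, stks [] s l [] []⟩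
    ⟨some .emit, { r with pos := false, last := false }.state, stks [] s [] l.reverse []⟩ := s1
  cases dec with
  | false =>
    obtain ⟨r', s2⟩ := runsIn_emit_nat { r with pos := false, last := false } s l.reverse [] rfl
    refine ⟨r', ?_⟩
    rw [List.map_reverse, List.foldl_reverse] at s2
    have : output false (digVal l) = trimBits (l.map Cell.dig) :=
      (trimBits_eq_encodeNat _).symm
    rw [this]
    exact (s1'.trans s2).mono (by rw [List.length_reverse]; omega)
  | true =>
    obtain ⟨r', s2⟩ := runsIn_emit_dec { r with pos := false, last := false } s l.reverse []
    refine ⟨r', ?_⟩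
    rw [List.map_reverse, List.foldl_reverse] at s2
    cases l with
    | nil => exact absurd rfl hl
    | cons c l =>
      have : output true (digVal (c :: l)) = [!c.dig] := by
        simp only [output, if_true, digVal, List.map_cons, bitsVal]
        cases c.dig <;> simp [Nat.add_mod]
      rw [this]
      exact (s1'.trans s2).mono (by rw [List.length_reverse]; omega)

theorem runsIn_machine {dec : Bool} (L : List (List Bool)) (R : ℕ)
    (hR : ∀ T, lastsBits L T = decide (T ≤ R)) (hne : L ≠ [])
    (hlt : R < 2 ^ (encPiles L).length) :
    RunsIn dec (timeBound.eval (encPiles L).length)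
      ⟨some .start, (default : Reg).state, stks (encPiles L) [] [] [] []⟩
      ⟨none, (default : Reg).state, stks [] [] [] [] (output dec R)⟩ := by
  have hLN : L.length ≤ (encPiles L).length := length_le_encPiles L
  have hmem : ∀ xs ∈ L, xs.length < (encPiles L).length + 1 :=
    fun xs hx => Nat.lt_succ_of_le (length_le_encPiles_of_mem hx)
  obtain ⟨a, i, hi⟩ : ∃ a i, encPiles L = a :: i := by
    rcases hc : encPiles L with _ | ⟨a, i⟩
    · rw [hc] at hLN
      exact absurd (List.eq_nil_of_length_eq_zero (Nat.le_zero.1 hLN)) hne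
    · exact ⟨a, i, rfl⟩
  have hN : (encPiles L).length = i.length + 1 := by rw [hi]; rfl
  have s1 : RunsIn dec 1 ⟨some .start, (default : Reg).state, stks (encPiles L) [] [] [] []⟩
      ⟨some .init, { (default : Reg) with first := true }.state,
        stks (a :: i) [] [⟨false, false, false, false⟩] [] []⟩ :=
    .step (by simp [program, hi])
  have s2 : RunsIn dec 1
      ⟨some .init, { (default : Reg) with first := true }.state,
        stks (a :: i) [] [⟨false, false, false, false⟩] [] []⟩
      ⟨some .init, { (default : Reg) with first := false }.state,
        stks i [a] [⟨true, true, false, false⟩, ⟨false, false, false, false⟩] [] []⟩ :=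
    .step (by simp [program])
  have s3 := runsIn_init (dec := dec) { (default : Reg) with first := false } i [a]
    [⟨true, true, false, false⟩, ⟨false, false, false, false⟩] rfl
  rw [show i.reverse ++ [a] = (encPiles L).reverse by rw [hi, List.reverse_cons]] at s3
  obtain ⟨r, l, h1, h2, h3, s4⟩ := runsIn_search (dec := dec) L R hR
    ((encPiles L).length + 1) (by omega) hmem i.length { (default : Reg) with first := false }
    (List.replicate i.length ⟨true, false, false, false⟩ ++
      [⟨true, true, false, false⟩, ⟨false, false, false, false⟩]) [false]
    (by rw [hN]; simp) (by simp [shape, openShape]) (by simp [bitsVal])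
    (by simpa [bitsVal, ← hN] using hlt) (by simp [bitsVal, hN])
  obtain ⟨r', s5⟩ := runsIn_turn (dec := dec) r (encPiles L).reverse l h1
  rw [h3, h2] at s5
  have s6 := runsIn_clean (dec := dec) r' (encPiles L).reverse (output dec R)
  rw [List.length_reverse] at s6
  refine (((((s1.trans s2).trans s3).trans s4).trans s5).trans s6).mono ?_
  rw [← hN]
  simp only [timeBound, roundTime, Polynomial.eval_add, Polynomial.eval_mul, Polynomial.eval_pow,
    Polynomial.eval_X, Polynomial.eval_ofNat]
  -- Replacing the number of piles by the input length `N` gives the cubic term: `N` rounds, at most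
  -- `N` piles in each, `2 * (N + 2)` steps per pile.
  have := Nat.mul_le_mul_right ((encPiles L).length * (2 * ((encPiles L).length + 1 + 1))) hLN
  rw [hN] at this ⊢
  nlinarith

theorem lastsBits_ofFn {n : ℕ} (x : Fin n → ℕ) (T : ℕ) :
    lastsBits ((List.ofFn x).map encodeNat) T = true ↔ Lasts x T := by
  have hodd : ∀ i, oddBelow T (encodeNat (x i)) = true ↔ OddBelow x T i := by
    intro i
    simp only [oddBelow, bitsVal_encodeNat, OddBelow, Bool.and_eq_true, decide_eq_true_eq,
      Bool.not_eq_true', decide_eq_false_iff_not]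
    omega
  have hcost : (((List.ofFn x).map encodeNat).map (cost T)).sum = 2 * pairDeficit x T := by
    rw [List.map_map, List.map_ofFn, List.sum_ofFn, pairDeficit, Finset.mul_sum]
    simp [cost, bitsVal_encodeNat]
  have hany : ((List.ofFn x).map encodeNat).any (oddBelow T) = true ↔ ∃ i, OddBelow x T i := by
    simp [hodd]
  have hall : ((List.ofFn x).map encodeNat).all (oddBelow T) = true ↔ ∀ i, OddBelow x T i := by
    simp [hodd]
  have hbonus : (if decide (T % 2 = 1) = true then ((List.ofFn x).map encodeNat).any (oddBelow T)
      else ((List.ofFn x).map encodeNat).all (oddBelow T)) = true ↔ Bonus x T := by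
    unfold Bonus
    rw [← hany, ← hall]
    rcases Nat.mod_two_eq_zero_or_one T with h | h <;> simp [h]
  rw [lastsBits, hcost, Bool.and_eq_true, Bool.or_eq_true, hbonus]
  simp only [Bool.not_eq_true', decide_eq_false_iff_not, decide_eq_true_eq]
  unfold Lasts
  constructor
  · rintro ⟨h1, h2 | h2⟩
    · left; omega
    · right; exact ⟨h2, by omega⟩
  · rintro (h | ⟨h1, h2⟩)
    · exact ⟨by omega, .inl (by omega)⟩
    · exact ⟨by omega, .inr h1⟩

theorem encode_eq_encPiles (p : NimPosition) :
    p.encode = encPiles ((List.ofFn p.pile).map encodeNat) := by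
  rw [NimPosition.encode, encPiles, List.flatMap_map]

theorem machine_outputs (dec : Bool) (p : NimPosition) :
    RunsIn dec (timeBound.eval p.encode.length)
      ⟨some .start, (default : Reg).state, stks p.encode [] [] [] []⟩
      ⟨none, (default : Reg).state, stks [] [] [] [] (output dec p.rem)⟩ := by
  have hrem : p.rem = lastsMax p.pile := remoteness_nim p.two_le p.pile
  rw [encode_eq_encPiles]
  refine runsIn_machine _ _ (fun T => ?_) ?_ ?_
  · rw [Bool.eq_iff_iff, lastsBits_ofFn, decide_eq_true_iff, hrem, lasts_iff p.two_le]
  · have := p.two_le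
    intro h
    have := congrArg List.length h
    simp at this
    omega
  · refine lt_of_le_of_lt ?_ (sum_bitsVal_lt _)
    rw [hrem]
    refine (lastsMax_le_sum p.two_le p.pile).trans (le_of_eq ?_)
    rw [List.map_map, List.map_ofFn, List.sum_ofFn]
    simp [bitsVal_encodeNat]

theorem initList_machine (dec : Bool) (i : List Γ') :
    initList (machine dec) i = (⟨some .start, (default : Reg).state, stks i [] [] [] []⟩ : Config) := by
  unfold initList
  congr 1
  funext k
  cases k <;> rfl

theorem haltList_machine (dec : Bool) (o : List Bool) :
    haltList (machine dec) o = (⟨none, (default : Reg).state, stks [] [] [] [] o⟩ : Config) := by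
  unfold haltList
  congr 1
  funext k
  cases k <;> rfl

theorem polyTimeComputable_of_output {β : Type} (dec : Bool) (eb : β → List Bool)
    (f : NimPosition → β) (hf : ∀ p, eb (f p) = output dec p.rem) :
    PolyTimeComputable NimPosition.encode eb f := by
  refine ⟨⟨⟨machine dec, Equiv.refl Γ', Equiv.refl Bool⟩, timeBound, fun p => ?_⟩, fun k => ?_⟩
  · have h := (machine_outputs dec p).some
    rw [← initList_machine dec, ← haltList_machine dec, ← hf] at h
    -- The words are mapped through identity equivalences; stating the claim for variable words
    -- allows them to be replaced.
    have key : ∀ (i : List Γ') (o : List Bool), i = p.encode → o = eb (f p) →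
        TM2OutputsInTime (machine dec) i (some o) (timeBound.eval p.encode.length) := by
      rintro i o rfl rfl
      exact h
    exact key _ _ (List.map_id _) (List.map_id _)
  · change Finite (Alph k)
    cases k <;> infer_instance

end NimMachine

open Classical in
theorem theorem3 :
    PolyTimeComputable NimPosition.encode encodeNat NimPosition.rem ∧
      PolyTimeComputable NimPosition.encode encodeBool (fun p => decide p.IsP) := by
  refine ⟨NimMachine.polyTimeComputable_of_output false _ _ fun p => rfl,
    NimMachine.polyTimeComputable_of_output true _ _ fun p => ?_⟩
  have h : p.IsP ↔ p.rem % 2 = 0 := by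
    rw [NimPosition.IsP, NimPosition.rem, isPPosition_nim p.two_le, remoteness_nim p.two_le]
  change [decide p.IsP] = [decide (p.rem % 2 = 0)]
  simp only [h]
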